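/- **Setting.** Let $n\ge 1$, $m_1,\dots,m_n\ge 1$, $f_i=\frac1{m_i}\sum_{j=1}^{m_i}f_{i,j}$ and $f=\frac1n\sum_{i=1}^n f_i$, where every $f_{i,j}:\mathbb{R}^p\to\mathbb{R}$ is differentiable, $\mu$-strongly convex ($f_{i,j}(y)\ge f_{i,j}(x)+\langle\nabla f_{i,j}(x),y-x\rangle+\frac\mu2\|x-y\|^2$) and $L$-smooth ($\|\nabla f_{i,j}(x)-\nabla f_{i,j}(y)\|\le L\|x-y\|$), with $\mu,L>0$. Let $W=(w_{ir})\in\mathbb{R}^{n\times n}$ be primitive and doubly stochastic, with second largest singular value $\sigma$ ($\sigma=0$ if $n=1$). **GT-SVRG** with step-size $\alpha>0$ and inner-loop length $K\ge1$: the starting points $x_i^{0,0}\in\mathbb{R}^p$ are arbitrary and $y_i^{0,0}=v_i^{0,0}=\nabla f_i(x_i^{0,0})$. For $t\ge0$, $0\le k\le K-1$ and every node $i$, with $s_i^{t,k+1}$ drawn uniformly from $\{1,\dots,m_i\}$, all draws being independent, $$x_i^{t,k+1}=\sum_r w_{ir}x_r^{t,k}-\alpha y_i^{t,k},$$ $$v_i^{t,k+1}=\nabla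 f_{i,s_i^{t,k+1}}(x_i^{t,k+1})-\nabla f_{i,s_i^{t,k+1}}(x_i^{t,0})+\nabla f_i(x_i^{t,0}),$$ $$y_i^{t,k+1}=\sum_r w_{ir}y_r^{t,k}+v_i^{t,k+1}-v_i^{t,k},$$ and $x_i^{t+1,0}=x_i^{t,K}$, $y_i^{t+1,0}=y_i^{t,K}$, $v_i^{t+1,0}=v_i^{t,K}$. Write $\bar x^{t,k}=\frac1n\sum_i x_i^{t,k}$, $\bar y^{t,k}=\frac1n\sum_i y_i^{t,k}$, let $x^*$ be the unique minimizer of $f$ (it exists under these assumptions), and let $$u^{t,0}=\Big(\mathbb{E}\sum_i\|x_i^{t,0}-\bar x^{t,0}\|^2,\ \ \mathbb{E}\,n\|\bar x^{t,0}-x^*\|^2,\ \ \mathbb{E}\sum_i\|y_i^{t,0}-\bar y^{t,0}\|^2\Big)^{\top}\in\mathbb{R}^3.$$ Let $$G_\alpha=\begin{bmatrix}\frac{1+\sigma^2}{2}&0&\frac{2\alpha^2}{1-\sigma^2}\\ \frac{2L^2\alpha}{\mu}&1-\frac{\mu\alpha}{2}&0\\ \frac{100L^2}{1-\sigma^2}&\frac{70L^2}{1-\sigma^2}&\frac{1+\sigma^2}{2}+\frac{40L^2\alpha^2}{1-\sigma^2}\end{bmatrix},\qquad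 H_\alpha=\begin{bmatrix}0&0&0\\4L^2\alpha^2&4L^2\alpha^2&0\\ \frac{60L^2}{1-\sigma^2}&\frac{60L^2}{1-\sigma^2}&0\end{bmatrix}.$$ **Theorem.** If $\alpha>0$ and $K\ge1$ are chosen such that the spectral radius satisfies $$\rho\Big(G_\alpha^K+\sum_{r=1}^{K-1}G_\alpha^rH_\alpha\Big)<1,$$ then GT-SVRG converges linearly in the outer loop: there are constants $0\le\gamma<1$ and $C\ge0$, depending only on $\mu,L,\sigma,\alpha,K$, such that for all starting points, all $t\ge0$ and each component $l\in\{1,2,3\}$, the expectations are finite and $$u^{t,0}_l\le C\,\gamma^t\,\big(u^{0,0}_1+u^{0,0}_2+u^{0,0}_3\big).$$ In particular $\mathbb{E}\sum_i\|x_i^{t,0}-x^*\|^2=u^{t,0}_1+u^{t,0}_2$ tends to $0$ linearly in $t$. -/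

import Mathlib

open MeasureTheory ProbabilityTheory

noncomputable section

namespace GTSVRG

/-- The decision space `ℝᵖ` with its Euclidean norm. -/
abbrev Vec (p : ℕ) := EuclideanSpace ℝ (Fin p)

section Problem

variable {n p : ℕ} {m : Fin n → ℕ}

/-- Local objective of node `i`: `fᵢ = (1 / mᵢ) ∑ⱼ fᵢⱼ`. -/
def localObj (f : (i : Fin n) → Fin (m i) → Vec p → ℝ) (i : Fin n) (z : Vec p) : ℝ :=
  (1 / (m i : ℝ)) * ∑ j, f i j z

/-- Global objective: `f = (1 / n) ∑ᵢ fᵢ`. -/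
def globalObj (f : (i : Fin n) → Fin (m i) → Vec p → ℝ) (z : Vec p) : ℝ :=
  (1 / (n : ℝ)) * ∑ i, localObj f i z

end Problem

/-- `μ`-strong convexity of a differentiable function, in first-order form. -/
def IsStronglyConvex {p : ℕ} (μ : ℝ) (g : Vec p → ℝ) : Prop :=
  ∀ x y, g x + inner ℝ (gradient g x) (y - x) + μ / 2 * ‖x - y‖ ^ 2 ≤ g y

/-- `L`-smoothness of a differentiable function: its gradient is `L`-Lipschitz. -/
def IsSmooth {p : ℕ} (L : ℝ) (g : Vec p → ℝ) : Prop :=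
  ∀ x y, ‖gradient g x - gradient g y‖ ≤ L * ‖x - y‖

/-- Second largest singular value, counted with multiplicity, of a square matrix
(the sequence `singularValues` is antitone and indexed from `0`; for a `1 × 1` matrix the value
is `0`). -/
def secondSingularValue {n : ℕ} (W : Matrix (Fin n) (Fin n) ℝ) : ℝ :=
  (Matrix.toEuclideanLin W).singularValues 1

/-- Average over the nodes. -/
def avg {n p : ℕ} (x : Fin n → Vec p) : Vec p := (1 / (n : ℝ)) • ∑ i, x i

/-- What the `n` nodes hold: the estimates `x`, the gradient trackers `y` and the local SVRG
gradients `v`. -/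
structure State (n p : ℕ) where
  x : Fin n → Vec p
  y : Fin n → Vec p
  v : Fin n → Vec p

section Algorithm

variable {n p : ℕ} {m : Fin n → ℕ}

/-- One inner-loop iteration. Here `z i` is the estimate of node `i` at the beginning of the
current inner loop, where the local full gradients are computed, and `s i` is the index drawn by
node `i`. -/
def innerStep (W : Matrix (Fin n) (Fin n) ℝ) (α : ℝ)
    (f : (i : Fin n) → Fin (m i) → Vec p → ℝ) (z : Fin n → Vec p)
    (s : (i : Fin n) → Fin (m i)) (S : State n p) : State n p :=
  let x' : Fin n → Vec p := fun i => (∑ r, W i r • S.x r) - α • S.y i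
  let v' : Fin n → Vec p := fun i =>
    gradient (f i (s i)) (x' i) - gradient (f i (s i)) (z i) + gradient (localObj f i) (z i)
  { x := x'
    y := fun i => (∑ r, W i r • S.y r) + v' i - S.v i
    v := v' }

/-- The state after `k` iterations of an inner loop started at `S`; `s k` holds the indices
drawn in the step from `k` to `k + 1`. -/
def innerLoop (W : Matrix (Fin n) (Fin n) ℝ) (α : ℝ)
    (f : (i : Fin n) → Fin (m i) → Vec p → ℝ)
    (s : ℕ → (i : Fin n) → Fin (m i)) (S : State n p) : ℕ → State n p
  | 0 => S
  | k + 1 => innerStep W α f S.x (s k) (innerLoop W α f s S k)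

/-- The state at the beginning of each outer loop `t`. Initially `x` is the starting point and
`yᵢ = vᵢ = ∇fᵢ(xᵢ)`; the state after the `K` iterations of an inner loop is carried over. -/
def outerLoop (W : Matrix (Fin n) (Fin n) ℝ) (α : ℝ)
    (f : (i : Fin n) → Fin (m i) → Vec p → ℝ) (K : ℕ) (x₀ : Fin n → Vec p)
    (s : ℕ → ℕ → (i : Fin n) → Fin (m i)) : ℕ → State n p
  | 0 =>
    { x := x₀
      y := fun i => gradient (localObj f i) (x₀ i)
      v := fun i => gradient (localObj f i) (x₀ i) }
  | t + 1 => innerLoop W α f (s t) (outerLoop W α f K x₀ s t) K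

end Algorithm

/-- The three squared errors of a state: consensus error, `n` times the squared distance of the
average estimate to `xstar`, and gradient tracking error. -/
def errors {n p : ℕ} (xstar : Vec p) (S : State n p) : Fin 3 → ℝ :=
  ![∑ i, ‖S.x i - avg S.x‖ ^ 2,
    (n : ℝ) * ‖avg S.x - xstar‖ ^ 2,
    ∑ i, ‖S.y i - avg S.y‖ ^ 2]

/-- The random indices `s t k i : Ω → Fin (m i)` (drawn by node `i` in the step from `k` to
`k + 1` of the inner loop of outer iteration `t`) are independent and uniformly distributed;
only the indices with `k < K` are ever used. -/
structure IsUniformSampling {n : ℕ} {m : Fin n → ℕ} (K : ℕ) {Ω : Type*} [MeasurableSpace Ω]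
    (P : Measure Ω) (s : ℕ → ℕ → (i : Fin n) → Ω → Fin (m i)) : Prop where
  measurable : ∀ t k i, k < K → Measurable (s t k i)
  uniform : ∀ t k i, k < K → ∀ j, P.real (s t k i ⁻¹' {j}) = 1 / (m i : ℝ)
  indep : iIndepFun (fun (q : ℕ × Fin K × Fin n) => s q.1 q.2.1 q.2.2) P

/-- The matrix `G_α`. -/
def matG (μ L σ α : ℝ) : Matrix (Fin 3) (Fin 3) ℝ :=
  !![(1 + σ ^ 2) / 2, 0, 2 * α ^ 2 / (1 - σ ^ 2);
     2 * L ^ 2 * α / μ, 1 - μ * α / 2, 0;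
     100 * L ^ 2 / (1 - σ ^ 2), 70 * L ^ 2 / (1 - σ ^ 2),
       (1 + σ ^ 2) / 2 + 40 * L ^ 2 * α ^ 2 / (1 - σ ^ 2)]

/-- The matrix `H_α`. -/
def matH (L σ α : ℝ) : Matrix (Fin 3) (Fin 3) ℝ :=
  !![0, 0, 0;
     4 * L ^ 2 * α ^ 2, 4 * L ^ 2 * α ^ 2, 0;
     60 * L ^ 2 / (1 - σ ^ 2), 60 * L ^ 2 / (1 - σ ^ 2), 0]

/-- The matrix `G_α ^ K + ∑_{r = 1}^{K - 1} G_α ^ r H_α`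
(`Finset.Ico 1 K` is `{1, …, K - 1}`). -/
def outerMatrix (μ L σ α : ℝ) (K : ℕ) : Matrix (Fin 3) (Fin 3) ℝ :=
  matG μ L σ α ^ K + ∑ r ∈ Finset.Ico 1 K, matG μ L σ α ^ r * matH L σ α

/-- Spectral radius of a real matrix: the largest modulus of its complex eigenvalues. -/
def rho {d : ℕ} (A : Matrix (Fin d) (Fin d) ℝ) : ENNReal :=
  spectralRadius ℂ (A.map (algebraMap ℝ ℂ))

end GTSVRG

end

/-! Write `G`, `H` and `M` for `matG`, `matH` and `outerMatrix`. The spectral condition on `M` is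
used only to extract positive weights `w` with `G w ≤ γ₀ w` and `γ₀ < 1`, together with a bound on
the step-size. The convergence proof then works with these weights alone, and `H` does not enter the
recursion.

Extracting the weights requires `G` to be entrywise nonnegative, that is `μ α ≤ 2`. If `μ α > 2`,
then `M` preserves a cone on which the third coordinate never decreases, so its powers cannot tend
to `0` (`mul_le_two_of_rho_lt_one`). Once `G` is nonnegative, `G ^ K ≤ M` on nonnegative vectors, so
some power `G ^ N` maps the all-ones vector below `1/2`, and `w = ∑_{r < N} G ^ r 1` is contracted
(`exists_weights`). Going once around the cycle of the three row inequalities of `G w ≤ w` forces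
`2240 L⁴ α² ≤ μ²` (`step_size_bound`). This makes every higher-order term in the error estimates
small.

The probabilistic core is `MeanBound.errors_innerStep_le`. Suppose the mean errors are at most `c
w`, and the reference points behind both the old and the new SVRG gradients have mean squared
distance at most `c (w 0 + w 1)` from the minimizer. Then the next mean errors are at most `c G w`.
Its ingredients are contraction of the disagreement by the second singular value, descent of the
average along the exact gradient, and vanishing of the noise cross terms because each draw is
uniform and independent of the past.

The first step of an inner loop still sees gradients computed at the reference point of the previous
loop. One contraction factor is spent on this lag: with `γ ^ 2 ≥ γ₀`, the invariant `MeanBound`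
carries a constant that is a factor `γ` behind the errors at the start of each loop, and every outer
iteration gains a factor `γ` (`Contractive.loopState_bound`, `Contractive.outerLoop_bound`). -/

namespace GTSVRG

open Filter Topology Matrix

/-! ### Spectral radius, powers, and the shape of the two matrices. -/

section SpectralRadius

attribute [local instance] Matrix.linftyOpNormedRing Matrix.linftyOpNormedAlgebra

/-- Gelfand's formula gives `‖B ^ t‖ ≤ r ^ t` eventually, for any `r` between the spectral radius
and `1`; real entries are recovered as real parts. -/
lemma tendsto_pow_of_rho_lt_one {d : ℕ} {A : Matrix (Fin d) (Fin d) ℝ} (h : rho A < 1)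
    (i j : Fin d) : Tendsto (fun t : ℕ => (A ^ t) i j) atTop (𝓝 0) := by
  set B : Matrix (Fin d) (Fin d) ℂ := A.map (algebraMap ℝ ℂ) with hB
  have hlim := spectrum.pow_nnnorm_pow_one_div_tendsto_nhds_spectralRadius B
  obtain ⟨r, hr1, hr2⟩ := ENNReal.lt_iff_exists_nnreal_btwn.1 h
  have hr2' : r < 1 := by exact_mod_cast hr2
  have hev : ∀ᶠ t : ℕ in atTop, ‖B ^ t‖ ≤ (r : ℝ) ^ t := by
    filter_upwards [hlim.eventually (gt_mem_nhds hr1), eventually_gt_atTop 0] with t ht ht0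
    have h1 : (‖B ^ t‖₊ : ENNReal) ≤ (r : ENNReal) ^ t := by
      have h2 := ENNReal.rpow_le_rpow ht.le (Nat.cast_nonneg t : (0 : ℝ) ≤ t)
      rw [← ENNReal.rpow_mul, one_div_mul_cancel (by positivity), ENNReal.rpow_one,
        ENNReal.rpow_natCast] at h2
      exact h2
    exact_mod_cast h1
  have hBlim : Tendsto (fun t : ℕ => B ^ t) atTop (𝓝 0) := by
    refine squeeze_zero_norm' hev ?_
    exact tendsto_pow_atTop_nhds_zero_of_lt_one r.2 (by exact_mod_cast hr2')
  have hij : Tendsto (fun t : ℕ => (B ^ t) i j) atTop (𝓝 0) := by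
    have := (tendsto_pi_nhds.1 ((tendsto_pi_nhds.1 hBlim) i)) j
    simpa using this
  have hre := (Complex.continuous_re.tendsto _).comp hij
  refine (hre.congr fun t => ?_)
  have : B ^ t = (A ^ t).map (algebraMap ℝ ℂ) := by
    rw [hB]
    exact ((algebraMap ℝ ℂ).mapMatrix.map_pow A t).symm
  simp [this]

end SpectralRadius

lemma tendsto_pow_mulVec_of_rho_lt_one {d : ℕ} {A : Matrix (Fin d) (Fin d) ℝ} (h : rho A < 1)
    (z : Fin d → ℝ) : Tendsto (fun t : ℕ => (A ^ t) *ᵥ z) atTop (𝓝 0) := by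
  refine tendsto_pi_nhds.2 fun i => ?_
  have := tendsto_finsetSum Finset.univ fun j _ =>
    (tendsto_pow_of_rho_lt_one h i j).mul_const (z j)
  simpa [Matrix.mulVec, dotProduct] using this

/-- The first factor of the rank-one matrix `H_α`. -/
noncomputable def vecH (L σ α : ℝ) : Fin 3 → ℝ := ![0, 4 * L ^ 2 * α ^ 2, 60 * L ^ 2 / (1 - σ ^ 2)]

/-- The matrix has rank one and sees only `z 0 + z 1`, so a single scalar decides the sign of its
whole contribution to `outerMatrix`. -/
lemma matH_mulVec (L σ α : ℝ) (z : Fin 3 → ℝ) :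
    matH L σ α *ᵥ z = (z 0 + z 1) • vecH L σ α := by
  ext i
  fin_cases i <;> simp [matH, vecH, Matrix.mulVec, dotProduct, Fin.sum_univ_three] <;> ring

lemma outerMatrix_mulVec (μ L σ α : ℝ) (K : ℕ) (z : Fin 3 → ℝ) :
    outerMatrix μ L σ α K *ᵥ z = matG μ L σ α ^ K *ᵥ z +
      (z 0 + z 1) • ∑ r ∈ Finset.Ico 1 K, matG μ L σ α ^ r *ᵥ vecH L σ α := by
  rw [outerMatrix, Matrix.add_mulVec, Matrix.sum_mulVec, Finset.smul_sum]
  simp [← Matrix.mulVec_mulVec, matH_mulVec, Matrix.mulVec_smul]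

lemma matG_mulVec_zero (μ L σ α : ℝ) (z : Fin 3 → ℝ) :
    (matG μ L σ α *ᵥ z) 0 = (1 + σ ^ 2) / 2 * z 0 + 2 * α ^ 2 / (1 - σ ^ 2) * z 2 := by
  simp [matG, Matrix.mulVec, dotProduct, Fin.sum_univ_three]

lemma matG_mulVec_one (μ L σ α : ℝ) (z : Fin 3 → ℝ) :
    (matG μ L σ α *ᵥ z) 1 = 2 * L ^ 2 * α / μ * z 0 + (1 - μ * α / 2) * z 1 := by
  simp [matG, Matrix.mulVec, dotProduct, Fin.sum_univ_three]

lemma matG_mulVec_two (μ L σ α : ℝ) (z : Fin 3 → ℝ) :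
    (matG μ L σ α *ᵥ z) 2 = 100 * L ^ 2 / (1 - σ ^ 2) * z 0 + 70 * L ^ 2 / (1 - σ ^ 2) * z 1 +
      ((1 + σ ^ 2) / 2 + 40 * L ^ 2 * α ^ 2 / (1 - σ ^ 2)) * z 2 := by
  simp [matG, Matrix.mulVec, dotProduct, Fin.sum_univ_three]

/-- For `σ = 1` the first row of `G_α` is that of the identity. -/
lemma not_rho_outerMatrix_lt_one_of_eq_one {μ L σ α : ℝ} {K : ℕ} (hσ : σ = 1) :
    ¬ rho (outerMatrix μ L σ α K) < 1 := by
  intro h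
  -- Division by `1 - σ ^ 2 = 0` yields `0`, so the first coordinate is conserved by all powers.
  have hG : ∀ z, (matG μ L σ α *ᵥ z) 0 = z 0 := by
    intro z
    rw [matG_mulVec_zero, hσ]
    norm_num
  have hGr : ∀ r z, ((matG μ L σ α) ^ r *ᵥ z) 0 = z 0 := by
    intro r
    induction r with
    | zero => simp
    | succ r ih => intro z; rw [pow_succ, ← Matrix.mulVec_mulVec, ih, hG]
  have hM : ∀ z, (outerMatrix μ L σ α K *ᵥ z) 0 = z 0 := by
    intro z
    rw [outerMatrix_mulVec]
    simp [hGr, vecH]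
  have hMt : ∀ t z, ((outerMatrix μ L σ α K) ^ t *ᵥ z) 0 = z 0 := by
    intro t
    induction t with
    | zero => simp
    | succ t ih => intro z; rw [pow_succ, ← Matrix.mulVec_mulVec, ih, hM]
  have hlim := (tendsto_pi_nhds.1 (tendsto_pow_mulVec_of_rho_lt_one h (fun _ => 1))) 0
  simp only [hMt] at hlim
  exact one_ne_zero (tendsto_nhds_unique tendsto_const_nhds hlim)

/-! ### Large step-sizes violate the spectral condition. -/

section LargeStep

/-- A cone preserved by the matrices `G_α` and `outerMatrix` when the step-size is large. -/
def stepCone (L α : ℝ) : Set (Fin 3 → ℝ) :=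
  {z | 0 ≤ z 0 ∧ 0 ≤ z 2 ∧ 0 ≤ 100 * L * z 1 + α * z 2}

lemma stepCone_add {L α : ℝ} {z z' : Fin 3 → ℝ} (h : z ∈ stepCone L α) (h' : z' ∈ stepCone L α) :
    z + z' ∈ stepCone L α := by
  obtain ⟨h1, h2, h3⟩ := h
  obtain ⟨h1', h2', h3'⟩ := h'
  refine ⟨?_, ?_, ?_⟩ <;> simp only [Pi.add_apply] <;> nlinarith

lemma stepCone_smul {L α c : ℝ} (hc : 0 ≤ c) {z : Fin 3 → ℝ} (h : z ∈ stepCone L α) :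
    c • z ∈ stepCone L α := by
  obtain ⟨h1, h2, h3⟩ := h
  refine ⟨mul_nonneg hc h1, mul_nonneg hc h2, ?_⟩
  have := mul_nonneg hc h3
  simp only [Pi.smul_apply, smul_eq_mul]
  linarith

variable {μ L σ α : ℝ}

lemma vecH_mem_stepCone (hL : 0 < L) (hα : 0 < α) (hσ0 : 0 ≤ σ) (hσ1 : σ < 1) :
    vecH L σ α ∈ stepCone L α := by
  have hs : 0 < 1 - σ ^ 2 := by nlinarith
  refine ⟨?_, ?_, ?_⟩ <;> simp [vecH] <;> positivity

/-- From `μ ≤ L` and `2 < μ * α` one gets `L * α > 2`, so the entry `40 L² α² / (1 - σ²)` dominates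
all negative contributions. The multiple of `vecH` is set aside because on the cone `z 0 + z 1 ≥ -(α
/ (100 L)) z 2`: it is exactly what compensates a negative factor in front of the `H`-part of
`outerMatrix`. -/
lemma matG_sub_mem_stepCone (hμ : 0 < μ) (hL : 0 < L) (hα : 0 < α) (hσ0 : 0 ≤ σ) (hσ1 : σ < 1)
    (hμL : μ ≤ L) (h : 2 < μ * α) {z : Fin 3 → ℝ} (hz : z ∈ stepCone L α) :
    matG μ L σ α *ᵥ z - (α / (100 * L) * z 2) • vecH L σ α ∈ stepCone L α ∧
      z 2 ≤ (matG μ L σ α *ᵥ z - (α / (100 * L) * z 2) • vecH L σ α) 2 := by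
  obtain ⟨h0, h2, h1⟩ := hz
  have hs : 0 < 1 - σ ^ 2 := by nlinarith
  set i : ℝ := (1 - σ ^ 2)⁻¹ with hi
  have hi1 : 1 ≤ i := (one_le_inv₀ hs).2 (by nlinarith)
  set e : ℝ := α / (100 * L) with he
  have heL : e * L = α / 100 := by rw [he]; field_simp
  have he0 : 0 < e := by positivity
  have hz1 : 0 ≤ z 1 + e * z 2 := by
    have : z 1 + e * z 2 = (100 * L * z 1 + α * z 2) / (100 * L) := by rw [he]; field_simp
    rw [this]; positivity
  have hθ : 2 < L * α := by nlinarith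
  have hθi : L * α ≤ L * α * i := by nlinarith
  have hθ2 : 2 * (L * α * i) ≤ L ^ 2 * α ^ 2 * i := by
    have : 0 ≤ L * α * i := by positivity
    nlinarith
  -- `13/10` is `(70 + 60)/100`: the `70` comes from replacing `z 1` by `z 1 + e * z 2`, the `60`
  -- from the subtracted `vecH`. The `-1` reserves one copy of `z 2` for monotonicity of the third
  -- coordinate.
  have hg : 0 ≤ (40 * (L ^ 2 * α ^ 2 * i) - 13 / 10 * (L * α * i) - 1) * z 2 :=
    mul_nonneg (by linarith) h2
  have e2 : (matG μ L σ α *ᵥ z - (e * z 2) • vecH L σ α) 2 =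
      100 * L ^ 2 * i * z 0 + 70 * L ^ 2 * i * (z 1 + e * z 2) + (1 + σ ^ 2) / 2 * z 2 + z 2
        + (40 * (L ^ 2 * α ^ 2 * i) - 13 / 10 * (L * α * i) - 1) * z 2 := by
    rw [Pi.sub_apply, matG_mulVec_two]
    simp only [vecH, Pi.smul_apply, smul_eq_mul, div_eq_mul_inv, ← hi, Matrix.cons_val]
    linear_combination (-130 * L * i * z 2) * heL
  have hthird : z 2 ≤ (matG μ L σ α *ᵥ z - (e * z 2) • vecH L σ α) 2 := by
    rw [e2]
    have t1 : 0 ≤ 100 * L ^ 2 * i * z 0 := by positivity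
    have t2 : 0 ≤ 70 * L ^ 2 * i * (z 1 + e * z 2) := by positivity
    have t3 : 0 ≤ (1 + σ ^ 2) / 2 * z 2 := by positivity
    linarith
  refine ⟨⟨?_, h2.trans hthird, ?_⟩, hthird⟩
  · rw [Pi.sub_apply, matG_mulVec_zero]
    simp only [vecH, Pi.smul_apply, smul_eq_mul, Matrix.cons_val]
    have t1 : 0 ≤ 2 * α ^ 2 / (1 - σ ^ 2) * z 2 := by positivity
    have t2 : 0 ≤ (1 + σ ^ 2) / 2 * z 0 := by positivity
    linarith
  -- The entry `1 - μ α / 2` is negative here; the entry `70 L² / (1 - σ²)` absorbs it because `μ ≤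
  -- L`.
  · have hd : 0 ≤ 100 * L * (1 - μ * α / 2) + 70 * L ^ 2 * α * i := by
      have a1 : L * (μ * α) ≤ L * (L * α) := by gcongr
      have a2 : L * (L * α) ≤ L * (L * α * i) := by gcongr
      have a3 : 0 ≤ L * (L * α) := by positivity
      nlinarith
    have e1 : (matG μ L σ α *ᵥ z - (e * z 2) • vecH L σ α) 1 =
        2 * L ^ 2 * α / μ * z 0 + (1 - μ * α / 2) * z 1 - e * z 2 * (4 * L ^ 2 * α ^ 2) := by
      rw [Pi.sub_apply, matG_mulVec_one]
      simp only [vecH, Pi.smul_apply, smul_eq_mul, Matrix.cons_val]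
    have key : 100 * L * (matG μ L σ α *ᵥ z - (e * z 2) • vecH L σ α) 1 +
        α * (matG μ L σ α *ᵥ z - (e * z 2) • vecH L σ α) 2 =
        100 * L * (2 * L ^ 2 * α / μ * z 0) + α * (100 * L ^ 2 * i * z 0) +
        α * ((1 + σ ^ 2) / 2 * z 2) +
        (100 * L * (1 - μ * α / 2) + 70 * L ^ 2 * α * i) * (z 1 + e * z 2) +
        α * (((μ * α) / 2 - 1) * z 2) +
        α * ((40 * (L ^ 2 * α ^ 2 * i) - 13 / 10 * (L * α * i) - 4 * (L ^ 2 * α ^ 2)) * z 2) := by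
      rw [e1, e2]
      linear_combination (-(100 * (1 - μ * α / 2) * z 2) - 400 * z 2 * L ^ 2 * α ^ 2) * heL
    rw [key]
    have t1 : 0 ≤ 100 * L * (2 * L ^ 2 * α / μ * z 0) := by positivity
    have t2 : 0 ≤ α * (100 * L ^ 2 * i * z 0) := by positivity
    have t3 : 0 ≤ α * ((1 + σ ^ 2) / 2 * z 2) := by positivity
    have t4 := mul_nonneg hd hz1
    have t5 : 0 ≤ α * (((μ * α) / 2 - 1) * z 2) :=
      mul_nonneg hα.le (mul_nonneg (by linarith) h2)
    have t6 : 0 ≤ α * ((40 * (L ^ 2 * α ^ 2 * i) - 13 / 10 * (L * α * i) -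
        4 * (L ^ 2 * α ^ 2)) * z 2) := by
      refine mul_nonneg hα.le (mul_nonneg ?_ h2)
      have : L ^ 2 * α ^ 2 ≤ L ^ 2 * α ^ 2 * i := le_mul_of_one_le_right (by positivity) hi1
      linarith
    linarith

lemma matG_mem_stepCone (hμ : 0 < μ) (hL : 0 < L) (hα : 0 < α) (hσ0 : 0 ≤ σ) (hσ1 : σ < 1)
    (hμL : μ ≤ L) (h : 2 < μ * α) {z : Fin 3 → ℝ} (hz : z ∈ stepCone L α) :
    matG μ L σ α *ᵥ z ∈ stepCone L α ∧ z 2 ≤ (matG μ L σ α *ᵥ z) 2 := by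
  obtain ⟨h1, h2⟩ := matG_sub_mem_stepCone hμ hL hα hσ0 hσ1 hμL h hz
  have hz2 := hz.2.1
  have hq := stepCone_smul (show 0 ≤ α / (100 * L) * z 2 by positivity)
    (vecH_mem_stepCone hL hα hσ0 hσ1)
  refine ⟨by simpa using stepCone_add h1 hq, h2.trans ?_⟩
  rw [Pi.sub_apply]
  linarith [hq.2.1]

lemma sum_pow_vecH_mem_stepCone (hμ : 0 < μ) (hL : 0 < L) (hα : 0 < α) (hσ0 : 0 ≤ σ) (hσ1 : σ < 1)
    (hμL : μ ≤ L) (h : 2 < μ * α) (s : Finset ℕ) :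
    ∑ r ∈ s, matG μ L σ α ^ r *ᵥ vecH L σ α ∈ stepCone L α := by
  have hr : ∀ r, matG μ L σ α ^ r *ᵥ vecH L σ α ∈ stepCone L α := by
    intro r
    induction r with
    | zero => simpa using vecH_mem_stepCone hL hα hσ0 hσ1
    | succ r ih =>
      rw [pow_succ', ← Matrix.mulVec_mulVec]
      exact (matG_mem_stepCone hμ hL hα hσ0 hσ1 hμL h ih).1
  induction s using Finset.induction_on with
  | empty => simp [stepCone]
  | insert a s ha ih => rw [Finset.sum_insert ha]; exact stepCone_add (hr a) ih

/-- Each application of `G` releases one multiple of `vecH`, which later applications turn into `G ^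
r *ᵥ vecH`. The released multiples do not decrease along the way, so the excess over the first one
stays in the cone. -/
lemma matG_pow_succ_mulVec_eq (hμ : 0 < μ) (hL : 0 < L) (hα : 0 < α) (hσ0 : 0 ≤ σ) (hσ1 : σ < 1)
    (hμL : μ ≤ L) (h : 2 < μ * α) (N : ℕ) : ∀ z ∈ stepCone L α, ∃ z' ∈ stepCone L α, z 2 ≤ z' 2 ∧
      matG μ L σ α ^ (N + 1) *ᵥ z = (α / (100 * L) * z 2) •
        ∑ r ∈ Finset.Ico 1 (N + 1), matG μ L σ α ^ r *ᵥ vecH L σ α + z' := by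
  induction N with
  | zero =>
    intro z hz
    obtain ⟨h1, h2⟩ := matG_mem_stepCone hμ hL hα hσ0 hσ1 hμL h hz
    exact ⟨_, h1, h2, by simp⟩
  | succ N ih =>
    intro z hz
    obtain ⟨h1, h2⟩ := matG_sub_mem_stepCone hμ hL hα hσ0 hσ1 hμL h hz
    set z₁ := matG μ L σ α *ᵥ z - (α / (100 * L) * z 2) • vecH L σ α with hz₁
    obtain ⟨z', hz', hle, heq⟩ := ih z₁ h1
    have hS := sum_pow_vecH_mem_stepCone hμ hL hα hσ0 hσ1 hμL h (Finset.Ico 1 (N + 1))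
    have hc : 0 ≤ α / (100 * L) * (z₁ 2 - z 2) := mul_nonneg (by positivity) (by linarith)
    have hcS := stepCone_smul hc hS
    refine ⟨_, stepCone_add hcS hz', ?_, ?_⟩
    · rw [Pi.add_apply]
      linarith [hcS.2.1]
    · have hG : matG μ L σ α *ᵥ z = z₁ + (α / (100 * L) * z 2) • vecH L σ α := by simp [hz₁]
      rw [pow_succ, ← Matrix.mulVec_mulVec, hG, Matrix.mulVec_add, heq, Matrix.mulVec_smul,
        Finset.sum_Ico_succ_top (by omega : 1 ≤ N + 1)]
      module

/-- The multiple split off from `G ^ K` turns the factor `z 0 + z 1` into `z 0 + (z 1 + α / (100 L)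
z 2)`, which is nonnegative on the cone. -/
lemma outerMatrix_mem_stepCone (hμ : 0 < μ) (hL : 0 < L) (hα : 0 < α) (hσ0 : 0 ≤ σ) (hσ1 : σ < 1)
    (hμL : μ ≤ L) (h : 2 < μ * α) {K : ℕ} (hK : 0 < K) {z : Fin 3 → ℝ} (hz : z ∈ stepCone L α) :
    outerMatrix μ L σ α K *ᵥ z ∈ stepCone L α ∧ z 2 ≤ (outerMatrix μ L σ α K *ᵥ z) 2 := by
  obtain ⟨N, rfl⟩ : ∃ N, K = N + 1 := ⟨K - 1, by omega⟩
  obtain ⟨z', hz', hle, heq⟩ := matG_pow_succ_mulVec_eq hμ hL hα hσ0 hσ1 hμL h N z hz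
  obtain ⟨h0, h2, h1⟩ := hz
  have hc : 0 ≤ z 0 + (z 1 + α / (100 * L) * z 2) := by
    have : z 1 + α / (100 * L) * z 2 = (100 * L * z 1 + α * z 2) / (100 * L) := by field_simp
    rw [this]; positivity
  have hS := stepCone_smul hc
    (sum_pow_vecH_mem_stepCone hμ hL hα hσ0 hσ1 hμL h (Finset.Ico 1 (N + 1)))
  have hM : outerMatrix μ L σ α (N + 1) *ᵥ z = (z 0 + (z 1 + α / (100 * L) * z 2)) •
      ∑ r ∈ Finset.Ico 1 (N + 1), matG μ L σ α ^ r *ᵥ vecH L σ α + z' := by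
    rw [outerMatrix_mulVec, heq]
    module
  rw [hM]
  refine ⟨stepCone_add hS hz', ?_⟩
  rw [Pi.add_apply]
  linarith [hS.2.1]

/-- The spectral condition bounds the step-size. -/
lemma mul_le_two_of_rho_lt_one (hμ : 0 < μ) (hL : 0 < L) (hα : 0 < α) (hσ0 : 0 ≤ σ) (hσ1 : σ < 1)
    (hμL : μ ≤ L) {K : ℕ} (hK : 0 < K) (hρ : rho (outerMatrix μ L σ α K) < 1) : μ * α ≤ 2 := by
  by_contra! h
  -- The orbit of this vector keeps its third coordinate at least `1`, so it cannot tend to `0`.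
  have hz : (![0, 0, 1] : Fin 3 → ℝ) ∈ stepCone L α := by
    refine ⟨?_, ?_, ?_⟩ <;> simp [hα.le]
  have hall : ∀ t : ℕ, outerMatrix μ L σ α K ^ t *ᵥ ![0, 0, 1] ∈ stepCone L α ∧
      1 ≤ (outerMatrix μ L σ α K ^ t *ᵥ ![0, 0, 1]) 2 := by
    intro t
    induction t with
    | zero => simpa using hz
    | succ t ih =>
      rw [pow_succ', ← Matrix.mulVec_mulVec]
      obtain ⟨h1, h2⟩ := outerMatrix_mem_stepCone hμ hL hα hσ0 hσ1 hμL h hK ih.1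
      exact ⟨h1, ih.2.trans h2⟩
  have hlim := (tendsto_pi_nhds.1 (tendsto_pow_mulVec_of_rho_lt_one hρ ![0, 0, 1])) 2
  have := ge_of_tendsto' hlim fun t => (hall t).2
  simp at this
  linarith

end LargeStep

/-! ### Contracted weights and the resulting bound on the step-size. -/

section Weights

variable {μ L σ α : ℝ}

lemma mulVec_mono_of_nonneg {d : ℕ} {A : Matrix (Fin d) (Fin d) ℝ} (hA : ∀ i j, 0 ≤ A i j)
    {z z' : Fin d → ℝ} (h : z ≤ z') : A *ᵥ z ≤ A *ᵥ z' := fun i => by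
  simp only [Matrix.mulVec, dotProduct]
  exact Finset.sum_le_sum fun j _ => mul_le_mul_of_nonneg_left (h j) (hA i j)

lemma matG_nonneg (hμ : 0 < μ) (hα : 0 < α) (hσ0 : 0 ≤ σ) (hσ1 : σ < 1)
    (h : μ * α ≤ 2) (i j : Fin 3) : 0 ≤ matG μ L σ α i j := by
  have hs : 0 < 1 - σ ^ 2 := by nlinarith
  fin_cases i <;> fin_cases j <;> simp [matG] <;> first | positivity | linarith

lemma vecH_nonneg (hσ0 : 0 ≤ σ) (hσ1 : σ < 1) : 0 ≤ vecH L σ α := by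
  have hs : 0 < 1 - σ ^ 2 := by nlinarith
  intro i
  fin_cases i <;> simp [vecH] <;> positivity

/-- The spectral condition gives positive weights contracted by `G_α`. -/
lemma exists_weights (hμ : 0 < μ) (hL : 0 < L) (hα : 0 < α) (hσ0 : 0 ≤ σ) (hσ1 : σ < 1)
    (hμL : μ ≤ L) {K : ℕ} (hK : 0 < K) (hρ : rho (outerMatrix μ L σ α K) < 1) :
    ∃ (w : Fin 3 → ℝ) (γ : ℝ), 0 ≤ γ ∧ γ < 1 ∧ (∀ i, 1 ≤ w i) ∧
      ∀ i, (matG μ L σ α *ᵥ w) i ≤ γ * w i := by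
  have h2 := mul_le_two_of_rho_lt_one hμ hL hα hσ0 hσ1 hμL hK hρ
  set G := matG μ L σ α with hGdef
  set M := outerMatrix μ L σ α K with hMdef
  have hG : ∀ i j, 0 ≤ G i j := matG_nonneg hμ hα hσ0 hσ1 h2
  have hGpow : ∀ (r : ℕ) (z : Fin 3 → ℝ), 0 ≤ z → 0 ≤ G ^ r *ᵥ z := by
    intro r
    induction r with
    | zero => intro z hz; simpa using hz
    | succ r ih =>
      intro z hz
      rw [pow_succ, ← Matrix.mulVec_mulVec]
      exact ih _ (by simpa using mulVec_mono_of_nonneg hG hz)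
  have hGmono : ∀ (r : ℕ) (z z' : Fin 3 → ℝ), z ≤ z' → G ^ r *ᵥ z ≤ G ^ r *ᵥ z' := by
    intro r z z' h
    have := hGpow r (z' - z) (sub_nonneg.2 h)
    rw [Matrix.mulVec_sub] at this
    exact sub_nonneg.1 this
  have hM : ∀ z : Fin 3 → ℝ, 0 ≤ z → G ^ K *ᵥ z ≤ M *ᵥ z := by
    intro z hz
    rw [hMdef, outerMatrix_mulVec]
    refine le_add_of_nonneg_right (smul_nonneg (add_nonneg (hz 0) (hz 1)) ?_)
    exact Finset.sum_nonneg fun r _ => hGpow r _ (vecH_nonneg hσ0 hσ1)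
  -- Discarding the nonnegative `H`-part `t` times compares `G ^ (K * t)` with `M ^ t`.
  have hMt : ∀ t : ℕ, 0 ≤ M ^ t *ᵥ (1 : Fin 3 → ℝ) ∧
      G ^ (K * t) *ᵥ (1 : Fin 3 → ℝ) ≤ M ^ t *ᵥ (1 : Fin 3 → ℝ) := by
    intro t
    induction t with
    | zero => simp
    | succ t ih =>
      have h1 := hM _ ih.1
      rw [pow_succ' M, ← Matrix.mulVec_mulVec, Nat.mul_succ, add_comm, pow_add,
        ← Matrix.mulVec_mulVec]
      exact ⟨(hGpow K _ ih.1).trans h1, (hGmono K _ _ ih.2).trans h1⟩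
  have hlim := tendsto_pow_mulVec_of_rho_lt_one hρ (1 : Fin 3 → ℝ)
  have hev : ∀ᶠ t : ℕ in atTop, ∀ i, (M ^ t *ᵥ (1 : Fin 3 → ℝ)) i < 1 / 2 := by
    rw [eventually_all]
    intro i
    exact ((tendsto_pi_nhds.1 hlim) i).eventually (gt_mem_nhds (by norm_num))
  obtain ⟨t, ht, htpos⟩ := (hev.and (eventually_gt_atTop 0)).exists
  set N := K * t with hN
  have hNpos : 0 < N := Nat.mul_pos hK htpos
  set w : Fin 3 → ℝ := ∑ r ∈ Finset.range N, G ^ r *ᵥ (1 : Fin 3 → ℝ) with hw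
  have hw1 : ∀ i, 1 ≤ w i := by
    intro i
    have := Finset.single_le_sum (f := fun r => (G ^ r *ᵥ (1 : Fin 3 → ℝ)) i)
      (fun r _ => hGpow r 1 zero_le_one i) (Finset.mem_range.2 hNpos)
    simpa [hw, Finset.sum_apply] using this
  have hGw : ∀ i, (G *ᵥ w) i ≤ w i - 1 / 2 := by
    intro i
    -- Telescoping: `G` shifts the sum defining `w` by one index.
    have e : G *ᵥ w + 1 = w + G ^ N *ᵥ (1 : Fin 3 → ℝ) := by
      have h3 : G *ᵥ w = ∑ r ∈ Finset.range N, G ^ (r + 1) *ᵥ (1 : Fin 3 → ℝ) := by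
        rw [hw, Matrix.mulVec_sum]
        simp [pow_succ']
      rw [h3, hw, ← Finset.sum_range_succ, Finset.sum_range_succ']
      simp
    have e' := congrFun e i
    have h4 := (hMt t).2 i
    have h5 := ht i
    simp only [Pi.add_apply, Pi.one_apply] at e'
    linarith
  set b := w 0 + w 1 + w 2 with hb
  have hb1 : 1 ≤ b := by linarith [hw1 0, hw1 1, hw1 2]
  -- Since `w i ≤ b`, the absolute gain `1/2` is at least the fraction `1 / (2 * b)` of `w i`.
  refine ⟨w, 1 - 1 / (2 * b), ?_, ?_, hw1, fun i => (hGw i).trans ?_⟩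
  · rw [sub_nonneg, div_le_one (by positivity)]
    linarith
  · have : 0 < 1 / (2 * b) := by positivity
    linarith
  · have hwb : w i ≤ b := by
      fin_cases i <;> simp [hb] <;> linarith [hw1 0, hw1 1, hw1 2]
    have : 1 / (2 * b) * w i ≤ 1 / (2 * b) * b := by gcongr
    have h6 : 1 / (2 * b) * b = 1 / 2 := by field_simp
    linarith

/-- Positive weights strictly contracted by `G_α` force the step-size to be small. -/
lemma step_size_bound (hμ : 0 < μ) (hα : 0 < α) (hσ0 : 0 ≤ σ) (hσ1 : σ < 1)
    {w : Fin 3 → ℝ} {γ : ℝ} (hγ : γ < 1) (hw : ∀ i, 1 ≤ w i)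
    (hG : ∀ i, (matG μ L σ α *ᵥ w) i ≤ γ * w i) :
    2240 * (L ^ 4 * α ^ 2) ≤ μ ^ 2 := by
  have hs : 0 < 1 - σ ^ 2 := by nlinarith
  have hs1 : 1 - σ ^ 2 ≤ 1 := by nlinarith
  have hlt : ∀ i, (matG μ L σ α *ᵥ w) i ≤ w i := fun i =>
    (hG i).trans (by nlinarith [hw i])
  have hw0 : ∀ i, 0 < w i := fun i => one_pos.trans_le (hw i)
  have r0 := hlt 0
  have r1 := hlt 1
  have r2 := hlt 2
  rw [matG_mulVec_zero] at r0
  rw [matG_mulVec_one] at r1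
  rw [matG_mulVec_two] at r2
  set s := 1 - σ ^ 2 with hsdef
  have hσs : σ ^ 2 = 1 - s := by simp [hsdef]
  rw [hσs] at r0 r2
  have p0 := hw0 0
  have p1 := hw0 1
  have p2 := hw0 2
  have b0 : 4 * α ^ 2 * w 2 ≤ w 0 := by
    have : 2 * α ^ 2 / s * w 2 ≤ s / 2 * w 0 := by linarith
    have h1 : 2 * α ^ 2 * w 2 ≤ s / 2 * w 0 * s := by
      rw [div_mul_eq_mul_div, div_le_iff₀ hs] at this
      exact this
    have h2 : s / 2 * w 0 * s ≤ 1 / 2 * w 0 * 1 := by gcongr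
    linarith
  have b1 : 4 * L ^ 2 * w 0 ≤ μ ^ 2 * w 1 := by
    have : 2 * L ^ 2 * α / μ * w 0 ≤ μ * α / 2 * w 1 := by linarith
    rw [div_mul_eq_mul_div, div_le_iff₀ hμ] at this
    refine le_of_mul_le_mul_left ?_ hα
    linarith
  have b2 : 140 * L ^ 2 * w 1 ≤ w 2 := by
    have t1 : 0 ≤ 100 * L ^ 2 / s * w 0 := by positivity
    have t2 : 0 ≤ 40 * L ^ 2 * α ^ 2 / s * w 2 := by positivity
    have : 70 * L ^ 2 / s * w 1 ≤ s / 2 * w 2 := by linarith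
    have h1 : 70 * L ^ 2 * w 1 ≤ s / 2 * w 2 * s := by
      rw [div_mul_eq_mul_div, div_le_iff₀ hs] at this
      exact this
    have h2 : s / 2 * w 2 * s ≤ 1 / 2 * w 2 * 1 := by gcongr
    linarith
  -- The inequalities `b0`, `b1`, `b2` form a cycle through the coordinates `2, 0, 1, 2`; the
  -- constant is `4 * 4 * 140 = 2240`.
  refine le_of_mul_le_mul_right ?_ p2
  calc 2240 * (L ^ 4 * α ^ 2) * w 2 = 560 * L ^ 4 * (4 * α ^ 2 * w 2) := by ring
    _ ≤ 560 * L ^ 4 * w 0 := by gcongr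
    _ = 140 * L ^ 2 * (4 * L ^ 2 * w 0) := by ring
    _ ≤ 140 * L ^ 2 * (μ ^ 2 * w 1) := by gcongr
    _ = μ ^ 2 * (140 * L ^ 2 * w 1) := by ring
    _ ≤ μ ^ 2 * w 2 := by gcongr

end Weights

end GTSVRG

namespace GTSVRG

open Filter Topology Matrix

/-! ### Singular values and contraction off the top singular vector. -/

section SingularValues

variable {E : Type*} [NormedAddCommGroup E] [InnerProductSpace ℝ E] [FiniteDimensional ℝ E]

lemma norm_sq_eq_inner_adjoint_comp (T : E →ₗ[ℝ] E) (z : E) :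
    ‖T z‖ ^ 2 = inner ℝ ((LinearMap.adjoint T ∘ₗ T) z) z := by
  rw [LinearMap.comp_apply, LinearMap.adjoint_inner_left, real_inner_self_eq_norm_sq]

lemma singularValues_le_one (T : E →ₗ[ℝ] E) (hT : ∀ z, ‖T z‖ ≤ ‖z‖) (k : ℕ) :
    T.singularValues k ≤ 1 := by
  by_cases hk : k < Module.finrank ℝ E
  · obtain ⟨v, hv⟩ := (T.hasEigenvalue_adjoint_comp_self_sq_singularValues hk).exists_hasEigenvector
    have h1 := norm_sq_eq_inner_adjoint_comp T v
    rw [hv.apply_eq_smul, inner_smul_left, real_inner_self_eq_norm_sq] at h1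
    have h2 : ‖T v‖ ^ 2 ≤ ‖v‖ ^ 2 := by gcongr; exact hT v
    have h3 : 0 < ‖v‖ ^ 2 := by have := norm_pos_iff.2 hv.2; positivity
    have h4 : T.singularValues k ^ 2 ≤ 1 := by
      refine le_of_mul_le_mul_right ?_ h3
      simpa [h1] using h2
    nlinarith [T.singularValues_nonneg k]
  · rw [T.singularValues_of_finrank_le (not_lt.1 hk)]
    exact zero_le_one

/-- If the largest singular value `1` is attained at `u`, the orthogonal complement of `u` is
contracted by the second singular value. -/
lemma norm_sq_le_of_inner_eq_zero (T : E →ₗ[ℝ] E) {u : E} (hu : u ≠ 0)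
    (hTu : (LinearMap.adjoint T ∘ₗ T) u = u) (hσ : T.singularValues 1 < 1) {z : E}
    (hz : inner ℝ u z = 0) : ‖T z‖ ^ 2 ≤ T.singularValues 1 ^ 2 * ‖z‖ ^ 2 := by
  set S := LinearMap.adjoint T ∘ₗ T with hS
  have hsym : S.IsSymmetric := T.isSymmetric_adjoint_comp_self
  obtain ⟨N, hN⟩ : ∃ N, Module.finrank ℝ E = N := ⟨_, rfl⟩
  set b := hsym.eigenvectorBasis hN with hb
  have hlam : ∀ i : Fin N, hsym.eigenvalues hN i = T.singularValues i ^ 2 := fun i =>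
    (T.sq_singularValues_fin hN i).symm
  have hSb : ∀ i, S (b i) = (T.singularValues i ^ 2) • b i := by
    intro i
    rw [hb, hsym.apply_eigenvectorBasis hN i, hlam]
    simp
  have hSin : ∀ x i, inner ℝ (S x) (b i) = T.singularValues i ^ 2 * inner ℝ x (b i) := by
    intro x i
    rw [hsym x (b i), hSb, inner_smul_right]
  have hle : ∀ i : Fin N, (i : ℕ) ≠ 0 → T.singularValues i ≤ T.singularValues 1 := fun i hi =>
    T.singularValues_antitone (Nat.one_le_iff_ne_zero.2 hi)
  have hsq : ∀ i : Fin N, (i : ℕ) ≠ 0 → T.singularValues i ^ 2 ≤ T.singularValues 1 ^ 2 :=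
    fun i hi => pow_le_pow_left₀ (T.singularValues_nonneg _) (hle i hi) 2
  -- `u` has eigenvalue `1` while these basis vectors have eigenvalue below `1`, so symmetry makes
  -- them orthogonal. Hence `u` is a multiple of the basis vector of index `0`.
  have hub : ∀ i : Fin N, (i : ℕ) ≠ 0 → inner ℝ u (b i) = 0 := by
    intro i hi
    have h1 := hSin u i
    rw [hTu] at h1
    have h2 := hsq i hi
    have h3 : T.singularValues 1 ^ 2 < 1 := by nlinarith [T.singularValues_nonneg 1]
    have h4 : (1 - T.singularValues i ^ 2) * inner ℝ u (b i) = 0 := by linarith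
    exact (mul_eq_zero.1 h4).resolve_left (by linarith)
  have hzb : ∀ i : Fin N, (i : ℕ) = 0 → inner ℝ z (b i) = 0 := by
    intro i hi
    have honly : ∀ j : Fin N, j ≠ i → inner ℝ u (b j) = 0 := fun j hj =>
      hub j fun h => hj (Fin.ext (h.trans hi.symm))
    have h1 := b.sum_inner_mul_inner u z
    rw [Finset.sum_eq_single i (fun j _ hj => by rw [honly j hj, zero_mul]) (by simp), hz] at h1
    have hne : inner ℝ u (b i) ≠ 0 := by
      intro h0
      have hall : ∀ j, inner ℝ u (b j) = 0 := fun j => by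
        by_cases hj : j = i
        · rw [hj, h0]
        · exact honly j hj
      have h2 := b.sum_inner_mul_inner u u
      simp only [hall, zero_mul, Finset.sum_const_zero] at h2
      exact hu (inner_self_eq_zero.1 h2.symm)
    rw [real_inner_comm]
    exact (mul_eq_zero.1 h1).resolve_left hne
  rw [norm_sq_eq_inner_adjoint_comp, ← real_inner_self_eq_norm_sq z, ← b.sum_inner_mul_inner,
    ← b.sum_inner_mul_inner z z, Finset.mul_sum]
  refine Finset.sum_le_sum fun i _ => ?_
  rw [hSin, real_inner_comm z (b i)]
  by_cases hi : (i : ℕ) = 0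
  · rw [hzb i hi]
    simp
  · have := mul_le_mul_of_nonneg_right (hsq i hi) (mul_self_nonneg (inner ℝ z (b i)))
    linarith

end SingularValues

/-! ### Doubly stochastic mixing. -/

section Mixing

variable {n : ℕ} {W : Matrix (Fin n) (Fin n) ℝ}

/-- Jensen's inequality for the square in each row, then unit column sums. -/
lemma norm_toEuclideanLin_le (hW : W ∈ doublyStochastic ℝ (Fin n)) (z : EuclideanSpace ℝ (Fin n)) :
    ‖Matrix.toEuclideanLin W z‖ ≤ ‖z‖ := by
  have h : ‖Matrix.toEuclideanLin W z‖ ^ 2 ≤ ‖z‖ ^ 2 := by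
    rw [EuclideanSpace.real_norm_sq_eq, EuclideanSpace.real_norm_sq_eq]
    calc ∑ i, (Matrix.toEuclideanLin W z) i ^ 2 ≤ ∑ i, ∑ r, W i r * z r ^ 2 := by
          refine Finset.sum_le_sum fun i _ => ?_
          have hj := (even_two.convexOn_pow (𝕜 := ℝ)).map_sum_le (t := Finset.univ) (w := W i)
            (p := z) (fun r _ => nonneg_of_mem_doublyStochastic hW)
            (sum_row_of_mem_doublyStochastic hW i) (fun _ _ => Set.mem_univ _)
          simpa [Matrix.toLpLin_apply, Matrix.mulVec, dotProduct] using hj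
      _ = ∑ r, z r ^ 2 := by
          rw [Finset.sum_comm]
          refine Finset.sum_congr rfl fun r _ => ?_
          rw [← Finset.sum_mul, sum_col_of_mem_doublyStochastic hW, one_mul]
  exact (pow_le_pow_iff_left₀ (norm_nonneg _) (norm_nonneg _) two_ne_zero).1 h

lemma secondSingularValue_nonneg (W : Matrix (Fin n) (Fin n) ℝ) : 0 ≤ secondSingularValue W :=
  LinearMap.singularValues_nonneg _ _

lemma secondSingularValue_le_one (hW : W ∈ doublyStochastic ℝ (Fin n)) :
    secondSingularValue W ≤ 1 :=
  singularValues_le_one _ (norm_toEuclideanLin_le hW) 1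

/-- The all-ones vector is fixed by both `W` and its transpose, so it is a singular vector for the
singular value `1`; zero-sum vectors are its orthogonal complement. -/
lemma norm_sq_toEuclideanLin_le (hW : W ∈ doublyStochastic ℝ (Fin n))
    (hσ : secondSingularValue W < 1) {z : EuclideanSpace ℝ (Fin n)} (hz : ∑ i, z i = 0) :
    ‖Matrix.toEuclideanLin W z‖ ^ 2 ≤ secondSingularValue W ^ 2 * ‖z‖ ^ 2 := by
  rcases isEmpty_or_nonempty (Fin n) with h | ⟨⟨i₀⟩⟩
  · simp [Subsingleton.elim z 0]
  have hu : (WithLp.toLp 2 1 : EuclideanSpace ℝ (Fin n)) ≠ 0 := by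
    intro h
    have := congrArg (fun v : EuclideanSpace ℝ (Fin n) => v i₀) h
    simp at this
  refine norm_sq_le_of_inner_eq_zero (Matrix.toEuclideanLin W) hu ?_ hσ ?_
  · rw [LinearMap.comp_apply, ← Matrix.toEuclideanLin_conjTranspose_eq_adjoint,
      Matrix.toLpLin_toLp, Matrix.toLpLin_toLp]
    simp only [Matrix.toLin'_apply, Matrix.conjTranspose_eq_transpose_of_trivial]
    rw [mulVec_one_of_mem_doublyStochastic hW, Matrix.mulVec_transpose,
      one_vecMul_of_mem_doublyStochastic hW]
  · simpa [PiLp.inner_apply] using hz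

lemma sum_norm_sq_eq_sum_coord {p : ℕ} (z : Fin n → Vec p) :
    ∑ i, ‖z i‖ ^ 2 = ∑ l, ‖(WithLp.toLp 2 fun i => z i l : EuclideanSpace ℝ (Fin n))‖ ^ 2 := by
  simp only [EuclideanSpace.real_norm_sq_eq]
  exact Finset.sum_comm

lemma toEuclideanLin_coord {p : ℕ} (z : Fin n → Vec p) (l : Fin p) :
    (WithLp.toLp 2 fun i => (∑ r, W i r • z r) l : EuclideanSpace ℝ (Fin n)) =
      Matrix.toEuclideanLin W (WithLp.toLp 2 fun i => z i l) := by
  ext i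
  simp [Matrix.toLpLin_apply, Matrix.mulVec, dotProduct]

lemma sum_norm_sq_mix_le {p : ℕ} (hW : W ∈ doublyStochastic ℝ (Fin n)) (z : Fin n → Vec p) :
    ∑ i, ‖∑ r, W i r • z r‖ ^ 2 ≤ ∑ i, ‖z i‖ ^ 2 := by
  rw [sum_norm_sq_eq_sum_coord (fun i => ∑ r, W i r • z r), sum_norm_sq_eq_sum_coord z]
  refine Finset.sum_le_sum fun l _ => ?_
  rw [toEuclideanLin_coord]
  gcongr
  exact norm_toEuclideanLin_le hW _

lemma sum_norm_sq_mix_le_of_sum_eq_zero {p : ℕ} (hW : W ∈ doublyStochastic ℝ (Fin n))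
    (hσ : secondSingularValue W < 1) {z : Fin n → Vec p} (hz : ∑ i, z i = 0) :
    ∑ i, ‖∑ r, W i r • z r‖ ^ 2 ≤ secondSingularValue W ^ 2 * ∑ i, ‖z i‖ ^ 2 := by
  rw [sum_norm_sq_eq_sum_coord (fun i => ∑ r, W i r • z r), sum_norm_sq_eq_sum_coord z,
    Finset.mul_sum]
  refine Finset.sum_le_sum fun l _ => ?_
  rw [toEuclideanLin_coord]
  refine norm_sq_toEuclideanLin_le hW hσ ?_
  have := congrArg (fun v : Vec p => v l) hz
  simpa using this

end Mixing

/-! ### Averages, variance decomposition and the consensus contraction. -/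

section Average

variable {n p : ℕ}

lemma smul_avg (hn : 0 < n) (x : Fin n → Vec p) : (n : ℝ) • avg x = ∑ i, x i := by
  rw [avg, smul_smul, mul_one_div_cancel (by positivity), one_smul]

lemma avg_add (x y : Fin n → Vec p) : avg (fun i => x i + y i) = avg x + avg y := by
  simp [avg, Finset.sum_add_distrib]

lemma avg_sub (x y : Fin n → Vec p) : avg (fun i => x i - y i) = avg x - avg y := by
  simp [avg, smul_sub]

lemma avg_smul (c : ℝ) (x : Fin n → Vec p) : avg (fun i => c • x i) = c • avg x := by
  simp only [avg, ← Finset.smul_sum, smul_comm c]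

lemma avg_mix {W : Matrix (Fin n) (Fin n) ℝ} (hW : W ∈ doublyStochastic ℝ (Fin n))
    (x : Fin n → Vec p) : avg (fun i => ∑ r, W i r • x r) = avg x := by
  simp only [avg]
  rw [Finset.sum_comm]
  simp only [← Finset.sum_smul, sum_col_of_mem_doublyStochastic hW, one_smul]

lemma sum_sub_avg (hn : 0 < n) (x : Fin n → Vec p) : ∑ i, (x i - avg x) = 0 := by
  rw [Finset.sum_sub_distrib, ← smul_avg hn, Finset.sum_const, Finset.card_univ, Fintype.card_fin,
    Nat.cast_smul_eq_nsmul, sub_self]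

lemma sum_norm_sub_sq (hn : 0 < n) (x : Fin n → Vec p) (a : Vec p) :
    ∑ i, ‖x i - a‖ ^ 2 = ∑ i, ‖x i - avg x‖ ^ 2 + n * ‖avg x - a‖ ^ 2 := by
  have h : ∀ i, ‖x i - a‖ ^ 2 = ‖x i - avg x‖ ^ 2 + 2 * inner ℝ (x i - avg x) (avg x - a) +
      ‖avg x - a‖ ^ 2 := fun i => by
    rw [← norm_add_sq_real, sub_add_sub_cancel]
  simp only [h, Finset.sum_add_distrib, ← Finset.mul_sum, ← sum_inner, sum_sub_avg hn]
  simp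

lemma sum_norm_sub_avg_sq_le (hn : 0 < n) (x : Fin n → Vec p) :
    ∑ i, ‖x i - avg x‖ ^ 2 ≤ ∑ i, ‖x i‖ ^ 2 := by
  have := sum_norm_sub_sq hn x 0
  simp only [sub_zero] at this
  rw [this]
  exact le_add_of_nonneg_right (by positivity)

lemma norm_avg_sq_le (hn : 0 < n) (x : Fin n → Vec p) :
    n * ‖avg x‖ ^ 2 ≤ ∑ i, ‖x i‖ ^ 2 := by
  have := sum_norm_sub_sq hn x 0
  simp only [sub_zero] at this
  rw [this]
  exact le_add_of_nonneg_left (by positivity)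

lemma norm_add_sq_le {V : Type*} [NormedAddCommGroup V] [InnerProductSpace ℝ V] {η : ℝ}
    (hη : 0 < η) (a b : V) : ‖a + b‖ ^ 2 ≤ (1 + η) * ‖a‖ ^ 2 + (1 + 1 / η) * ‖b‖ ^ 2 := by
  have h1 := norm_add_sq_real a b
  have h2 := real_inner_le_norm a b
  have h3 : 2 * (‖a‖ * ‖b‖) ≤ η * ‖a‖ ^ 2 + 1 / η * ‖b‖ ^ 2 := by
    have : η * ‖a‖ ^ 2 + 1 / η * ‖b‖ ^ 2 - 2 * (‖a‖ * ‖b‖) = (η * ‖a‖ - ‖b‖) ^ 2 / η := by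
      field_simp
      ring
    have h4 : 0 ≤ (η * ‖a‖ - ‖b‖) ^ 2 / η := by positivity
    linarith
  linarith

lemma sum_norm_add_sq_le {V : Type*} [NormedAddCommGroup V] [InnerProductSpace ℝ V] {η : ℝ}
    (hη : 0 < η) (a b : Fin n → V) :
    ∑ i, ‖a i + b i‖ ^ 2 ≤ (1 + η) * ∑ i, ‖a i‖ ^ 2 + (1 + 1 / η) * ∑ i, ‖b i‖ ^ 2 := by
  rw [Finset.mul_sum, Finset.mul_sum, ← Finset.sum_add_distrib]
  exact Finset.sum_le_sum fun i _ => norm_add_sq_le hη _ _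

/-- Mixing contracts the disagreement of `x`, up to a perturbation `b`. -/
lemma sum_norm_mix_add_sub_avg_sq_le (hn : 0 < n) {W : Matrix (Fin n) (Fin n) ℝ}
    (hW : W ∈ doublyStochastic ℝ (Fin n)) (hσ : secondSingularValue W < 1)
    (x b : Fin n → Vec p) :
    ∑ i, ‖(∑ r, W i r • x r) + b i - avg (fun i => (∑ r, W i r • x r) + b i)‖ ^ 2 ≤
      (1 + secondSingularValue W ^ 2) / 2 * ∑ i, ‖x i - avg x‖ ^ 2 +
        2 / (1 - secondSingularValue W ^ 2) * ∑ i, ‖b i - avg b‖ ^ 2 := by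
  set σ := secondSingularValue W with hσdef
  have hσ0 : 0 ≤ σ := secondSingularValue_nonneg W
  have hs : 0 < 1 - σ ^ 2 := by nlinarith
  -- This Young parameter gives `1 + 1/η = 2 / (1 - σ²)` exactly, and `(1 + η) σ² = 2σ² / (1 + σ²) ≤
  -- (1 + σ²) / 2`.
  set η : ℝ := (1 - σ ^ 2) / (1 + σ ^ 2) with hη
  have hη0 : 0 < η := by positivity
  have hrow : ∀ i, ∑ r, W i r • avg x = avg x := fun i => by
    rw [← Finset.sum_smul, sum_row_of_mem_doublyStochastic hW, one_smul]
  have hsplit : ∀ i, (∑ r, W i r • x r) + b i - avg (fun i => (∑ r, W i r • x r) + b i) =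
      (∑ r, W i r • (x r - avg x)) + (b i - avg b) := fun i => by
    rw [avg_add, avg_mix hW]
    simp only [smul_sub, Finset.sum_sub_distrib, hrow]
    abel
  have h1 := sum_norm_sq_mix_le_of_sum_eq_zero hW hσ (sum_sub_avg hn x)
  simp only [hsplit]
  refine (sum_norm_add_sq_le hη0 _ _).trans ?_
  have e : 1 + 1 / η = 2 / (1 - σ ^ 2) := by
    rw [hη]
    field_simp
    ring
  rw [e]
  gcongr ?_ + _
  refine (mul_le_mul_of_nonneg_left h1 (by positivity)).trans ?_
  rw [← mul_assoc]
  refine mul_le_mul_of_nonneg_right ?_ (by positivity)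
  have e2 : 1 + η = 2 / (1 + σ ^ 2) := by
    rw [hη]
    field_simp
    ring
  rw [e2, div_mul_eq_mul_div, div_le_iff₀ (by positivity)]
  nlinarith [sq_nonneg (σ ^ 2 - 1)]

end Average

end GTSVRG

namespace GTSVRG

open Filter Topology

/-! ### Gradients of means, strong convexity and the minimizer. -/

section Gradient

variable {p : ℕ}

lemma hasGradientAt_mean {N : ℕ} {g : Fin N → Vec p → ℝ} (hg : ∀ j, Differentiable ℝ (g j))
    (x : Vec p) : HasGradientAt (fun z => (1 / (N : ℝ)) * ∑ j, g j z)
      ((1 / (N : ℝ)) • ∑ j, gradient (g j) x) x := by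
  rw [hasGradientAt_iff_hasFDerivAt, map_smulₛₗ, map_sum]
  have h : ∀ j ∈ Finset.univ, HasFDerivAt (g j)
      (InnerProductSpace.toDual ℝ (Vec p) (gradient (g j) x)) x := fun j _ =>
    ((hg j) x).hasGradientAt.hasFDerivAt
  have := (HasFDerivAt.fun_sum h).const_mul (1 / (N : ℝ))
  simpa using this

lemma gradient_mean {N : ℕ} {g : Fin N → Vec p → ℝ} (hg : ∀ j, Differentiable ℝ (g j))
    (x : Vec p) : gradient (fun z => (1 / (N : ℝ)) * ∑ j, g j z) x =
      (1 / (N : ℝ)) • ∑ j, gradient (g j) x :=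
  (hasGradientAt_mean hg x).gradient

lemma differentiable_mean {N : ℕ} {g : Fin N → Vec p → ℝ} (hg : ∀ j, Differentiable ℝ (g j)) :
    Differentiable ℝ (fun z => (1 / (N : ℝ)) * ∑ j, g j z) := fun x =>
  (hasGradientAt_mean hg x).differentiableAt

lemma IsStronglyConvex.mean {N : ℕ} (hN : 0 < N) {μ : ℝ} {g : Fin N → Vec p → ℝ}
    (hg : ∀ j, Differentiable ℝ (g j)) (h : ∀ j, IsStronglyConvex μ (g j)) :
    IsStronglyConvex μ (fun z => (1 / (N : ℝ)) * ∑ j, g j z) := by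
  intro x y
  have hN' : (0 : ℝ) < N := by exact_mod_cast hN
  rw [gradient_mean hg, real_inner_smul_left, sum_inner]
  have h1 := Finset.sum_le_sum fun j (_ : j ∈ Finset.univ) => h j x y
  simp only [Finset.sum_add_distrib, Finset.sum_const, Finset.card_univ, Fintype.card_fin,
    nsmul_eq_mul] at h1
  have h2 := mul_le_mul_of_nonneg_left h1 (one_div_nonneg.2 hN'.le)
  have h3 : 1 / (N : ℝ) * (N * (μ / 2 * ‖x - y‖ ^ 2)) = μ / 2 * ‖x - y‖ ^ 2 := by
    field_simp
  linarith

lemma IsSmooth.mean {N : ℕ} (hN : 0 < N) {L : ℝ} {g : Fin N → Vec p → ℝ}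
    (hg : ∀ j, Differentiable ℝ (g j)) (h : ∀ j, IsSmooth L (g j)) :
    IsSmooth L (fun z => (1 / (N : ℝ)) * ∑ j, g j z) := by
  intro x y
  have hN' : (0 : ℝ) < N := by exact_mod_cast hN
  rw [gradient_mean hg, gradient_mean hg, ← smul_sub, ← Finset.sum_sub_distrib, norm_smul,
    Real.norm_of_nonneg (by positivity)]
  calc 1 / (N : ℝ) * ‖∑ j, (gradient (g j) x - gradient (g j) y)‖
      ≤ 1 / (N : ℝ) * ∑ _j : Fin N, L * ‖x - y‖ := by
        gcongr
        exact norm_sum_le_of_le _ fun j _ => h j x y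
    _ = L * ‖x - y‖ := by
        simp only [Finset.sum_const, Finset.card_univ, Fintype.card_fin, nsmul_eq_mul]
        field_simp

variable {μ L : ℝ} {g : Vec p → ℝ}

lemma IsStronglyConvex.inner_gradient_sub_ge (h : IsStronglyConvex μ g) (x y : Vec p) :
    μ * ‖x - y‖ ^ 2 ≤ inner ℝ (gradient g x - gradient g y) (x - y) := by
  have h1 := h x y
  have h2 := h y x
  rw [norm_sub_rev y x] at h2
  rw [← neg_sub x y, inner_neg_right] at h1
  rw [inner_sub_left]
  linarith

/-- Strong monotonicity and the Lipschitz bound give `μ ‖x - y‖² ≤ L ‖x - y‖²`. So `μ ≤ L` may be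
assumed except on the zero-dimensional space. -/
lemma subsingleton_of_lt (hc : IsStronglyConvex μ g) (hs : IsSmooth L g) (h : L < μ) :
    Subsingleton (Vec p) := by
  refine ⟨fun x y => ?_⟩
  by_contra hne
  have hpos : 0 < ‖x - y‖ := norm_pos_iff.2 (sub_ne_zero.2 hne)
  have h1 := hc.inner_gradient_sub_ge x y
  have h2 := (real_inner_le_norm _ _).trans
    (mul_le_mul_of_nonneg_right (hs x y) (norm_nonneg (x - y)))
  nlinarith [mul_pos hpos hpos]

lemma exists_minimizer (hμ : 0 < μ) (hd : Differentiable ℝ g) (hc : IsStronglyConvex μ g) :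
    ∃ xs, gradient g xs = 0 ∧ ∀ z, z ≠ xs → g xs < g z := by
  -- Strong convexity at `0` makes the quadratic term beat the linear one once `‖y‖ ≥ 2 ‖∇g(0)‖ /
  -- μ`, so continuity yields a global minimum.
  have hev : ∀ᶠ y in cocompact (Vec p), g 0 ≤ g y := by
    filter_upwards [(tendsto_norm_cocompact_atTop (E := Vec p)).eventually
      (eventually_ge_atTop (2 * ‖gradient g 0‖ / μ))] with y hy
    have h1 := hc 0 y
    simp only [sub_zero, zero_sub, norm_neg] at h1
    have h2 := neg_le_of_abs_le (abs_real_inner_le_norm (gradient g 0) y)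
    rw [div_le_iff₀ hμ] at hy
    nlinarith [norm_nonneg y]
  obtain ⟨xs, hxs⟩ := hd.continuous.exists_forall_le' 0 hev
  have hgrad : gradient g xs = 0 := by
    have hmin : IsLocalMin g xs := Filter.Eventually.of_forall hxs
    have := hmin.fderiv_eq_zero
    simp [gradient, this]
  refine ⟨xs, hgrad, fun z hz => ?_⟩
  have h1 := hc xs z
  rw [hgrad, inner_zero_left] at h1
  have : 0 < ‖xs - z‖ := norm_pos_iff.2 (sub_ne_zero.2 hz.symm)
  have : 0 < μ / 2 * ‖xs - z‖ ^ 2 := by positivity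
  linarith

end Gradient

/-! ### Local and global objectives; descent of the average. -/

section Objective

variable {n p : ℕ} {m : Fin n → ℕ} {f : (i : Fin n) → Fin (m i) → Vec p → ℝ} {μ L α : ℝ}

lemma gradient_localObj (hd : ∀ i j, Differentiable ℝ (f i j)) (i : Fin n) (x : Vec p) :
    gradient (localObj f i) x = (1 / (m i : ℝ)) • ∑ j, gradient (f i j) x :=
  gradient_mean (hd i) x

lemma differentiable_localObj (hd : ∀ i j, Differentiable ℝ (f i j)) (i : Fin n) :
    Differentiable ℝ (localObj f i) :=
  differentiable_mean (hd i)

lemma isSmooth_localObj (hm : ∀ i, 0 < m i) (hd : ∀ i j, Differentiable ℝ (f i j))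
    (hs : ∀ i j, IsSmooth L (f i j)) (i : Fin n) : IsSmooth L (localObj f i) :=
  IsSmooth.mean (hm i) (hd i) (hs i)

lemma gradient_globalObj (hd : ∀ i j, Differentiable ℝ (f i j)) (x : Vec p) :
    gradient (globalObj f) x = avg fun i => gradient (localObj f i) x :=
  gradient_mean (differentiable_localObj hd) x

lemma differentiable_globalObj (hd : ∀ i j, Differentiable ℝ (f i j)) :
    Differentiable ℝ (globalObj f) :=
  differentiable_mean (differentiable_localObj hd)

lemma isStronglyConvex_globalObj (hn : 0 < n) (hm : ∀ i, 0 < m i)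
    (hd : ∀ i j, Differentiable ℝ (f i j)) (hc : ∀ i j, IsStronglyConvex μ (f i j)) :
    IsStronglyConvex μ (globalObj f) :=
  IsStronglyConvex.mean hn (differentiable_localObj hd) fun i =>
    IsStronglyConvex.mean (hm i) (hd i) (hc i)

lemma isSmooth_globalObj (hn : 0 < n) (hm : ∀ i, 0 < m i)
    (hd : ∀ i j, Differentiable ℝ (f i j)) (hs : ∀ i j, IsSmooth L (f i j)) :
    IsSmooth L (globalObj f) :=
  IsSmooth.mean hn (differentiable_localObj hd) (isSmooth_localObj hm hd hs)

/-- The local gradients at the local estimates. -/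
noncomputable def localGrad (f : (i : Fin n) → Fin (m i) → Vec p → ℝ) (x : Fin n → Vec p) :
    Fin n → Vec p := fun i => gradient (localObj f i) (x i)

lemma IsSmooth.sq {g : Vec p → ℝ} (hs : IsSmooth L g) (x y : Vec p) :
    ‖gradient g x - gradient g y‖ ^ 2 ≤ L ^ 2 * ‖x - y‖ ^ 2 := by
  rw [← mul_pow]
  exact pow_le_pow_left₀ (norm_nonneg _) (hs x y) 2

lemma sum_norm_localGrad_sub_sq_le (hs : ∀ i, IsSmooth L (localObj f i)) (x y : Fin n → Vec p) :
    ∑ i, ‖localGrad f x i - localGrad f y i‖ ^ 2 ≤ L ^ 2 * ∑ i, ‖x i - y i‖ ^ 2 := by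
  rw [Finset.mul_sum]
  exact Finset.sum_le_sum fun i _ => (hs i).sq _ _

lemma norm_avg_localGrad_sq_le (hn : 0 < n) (hd : ∀ i j, Differentiable ℝ (f i j))
    (hs : ∀ i, IsSmooth L (localObj f i)) {xs : Vec p} (hxs : gradient (globalObj f) xs = 0)
    (x : Fin n → Vec p) :
    n * ‖avg (localGrad f x)‖ ^ 2 ≤ L ^ 2 * ∑ i, ‖x i - xs‖ ^ 2 := by
  have h : avg (localGrad f x) = avg fun i => localGrad f x i - localGrad f (fun _ => xs) i := by
    rw [avg_sub]
    rw [gradient_globalObj hd] at hxs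
    change _ = _ - avg fun i => gradient (localObj f i) xs
    rw [hxs, sub_zero]
  rw [h]
  exact (norm_avg_sq_le hn _).trans (sum_norm_localGrad_sub_sq_le hs x _)

lemma step_size_consequences (hμ : 0 < μ) (hα : 0 < α) (hμL : μ ≤ L)
    (hstep : 47 * (L ^ 2 * α) ≤ μ) :
    47 * (L ^ 2 * α ^ 2) ≤ μ * α ∧ 47 * (μ * α) ≤ 1 := by
  constructor
  · nlinarith
  · have h1 : μ ^ 2 ≤ L ^ 2 := pow_le_pow_left₀ hμ.le hμL 2
    have h2 : 47 * (μ ^ 2 * α) ≤ μ := le_trans (by gcongr) hstep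
    nlinarith

/-- Descent of the averaged estimate along the average of the local gradients. -/
lemma norm_avg_step_sq_le (hn : 0 < n) (hμ : 0 < μ) (hα : 0 < α) (hμL : μ ≤ L)
    (hstep : 47 * (L ^ 2 * α) ≤ μ) (hd : ∀ i j, Differentiable ℝ (f i j))
    (hs : ∀ i, IsSmooth L (localObj f i)) (hsg : IsSmooth L (globalObj f))
    (hc : IsStronglyConvex μ (globalObj f)) {xs : Vec p} (hxs : gradient (globalObj f) xs = 0)
    (x : Fin n → Vec p) :
    n * ‖avg x - α • avg (localGrad f x) - xs‖ ^ 2 ≤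
      (1 - 3 / 5 * (μ * α)) * (n * ‖avg x - xs‖ ^ 2) +
        3 / 2 * (L ^ 2 * α / μ) * ∑ i, ‖x i - avg x‖ ^ 2 := by
  obtain ⟨h1, h2⟩ := step_size_consequences hμ hα hμL hstep
  have hη : 0 < μ * α := by positivity
  set G := gradient (globalObj f) (avg x) with hG
  -- An exact gradient step at the average, plus the error of evaluating the local gradients at the
  -- `x i`. They are separated by Young's inequality with parameter `μ * α`.
  have hsplit : avg x - α • avg (localGrad f x) - xs =
      (avg x - xs - α • G) + α • (G - avg (localGrad f x)) := by
    rw [smul_sub]; abel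
  have hA : ‖avg x - xs - α • G‖ ^ 2 ≤ (1 - 2 * (μ * α) + μ * α / 47) * ‖avg x - xs‖ ^ 2 := by
    have e1 := hc.inner_gradient_sub_ge (avg x) xs
    have e2 := hsg.sq (avg x) xs
    rw [hxs, sub_zero, ← hG] at e1 e2
    rw [norm_sub_sq_real, real_inner_smul_right, norm_smul, mul_pow, Real.norm_eq_abs, sq_abs,
      real_inner_comm]
    have e3 := mul_le_mul_of_nonneg_left e2 (sq_nonneg α)
    have e4 := mul_le_mul_of_nonneg_left e1 hα.le
    have e5 : L ^ 2 * α ^ 2 * ‖avg x - xs‖ ^ 2 ≤ μ * α / 47 * ‖avg x - xs‖ ^ 2 := by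
      gcongr; linarith
    linarith
  have hB : n * ‖G - avg (localGrad f x)‖ ^ 2 ≤ L ^ 2 * ∑ i, ‖x i - avg x‖ ^ 2 := by
    have e1 : G - avg (localGrad f x) =
        avg fun i => localGrad f (fun _ => avg x) i - localGrad f x i := by
      rw [avg_sub, hG, gradient_globalObj hd]
      rfl
    rw [e1]
    refine (norm_avg_sq_le hn _).trans ((sum_norm_localGrad_sub_sq_le hs _ _).trans ?_)
    simp only [norm_sub_rev (avg x)]
    exact le_rfl
  have hn0 : (0 : ℝ) ≤ n := Nat.cast_nonneg n
  have hX : 0 ≤ ∑ i, ‖x i - avg x‖ ^ 2 := by positivity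
  have hU : 0 ≤ n * ‖avg x - xs‖ ^ 2 := by positivity
  rw [hsplit]
  have hY := norm_add_sq_le hη (avg x - xs - α • G) (α • (G - avg (localGrad f x)))
  rw [norm_smul, mul_pow, Real.norm_eq_abs, sq_abs] at hY
  calc (n : ℝ) * ‖avg x - xs - α • G + α • (G - avg (localGrad f x))‖ ^ 2
      ≤ n * ((1 + μ * α) * ((1 - 2 * (μ * α) + μ * α / 47) * ‖avg x - xs‖ ^ 2) +
          (1 + 1 / (μ * α)) * (α ^ 2 * ‖G - avg (localGrad f x)‖ ^ 2)) := by
        refine mul_le_mul_of_nonneg_left (hY.trans ?_) hn0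
        gcongr
    _ = (1 + μ * α) * (1 - 2 * (μ * α) + μ * α / 47) * (n * ‖avg x - xs‖ ^ 2) +
          (1 + μ * α) * (α / μ) * (n * ‖G - avg (localGrad f x)‖ ^ 2) := by
        field_simp
        ring
    _ ≤ (1 - 3 / 5 * (μ * α)) * (n * ‖avg x - xs‖ ^ 2) +
          (3 / 2) * (α / μ) * (L ^ 2 * ∑ i, ‖x i - avg x‖ ^ 2) := by
        gcongr
        · nlinarith
        · linarith
    _ = _ := by ring

end Objective

end GTSVRG

namespace GTSVRG

/-! ### Expectations over finitely many draws. -/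

section Sampling

variable {Ω : Type*} [MeasurableSpace Ω] {P : Measure Ω} [IsProbabilityMeasure P]
  {A : Type*} [Finite A] [MeasurableSpace A] [DiscreteMeasurableSpace A]

/-- All randomness up to a given step is a variable with finite range, so no measurability or moment
condition on the gradients is needed. -/
lemma integrable_comp_of_finite {X : Ω → A} (hX : Measurable X) (g : A → ℝ) :
    Integrable (fun ω => g (X ω)) P := by
  have hν : IsProbabilityMeasure (P.map X) := Measure.isProbabilityMeasure_map hX.aemeasurable
  exact (Integrable.of_finite (μ := P.map X) (f := g)).comp_measurable hX

lemma integral_comp_of_finite [Fintype A] {X : Ω → A} (hX : Measurable X) (g : A → ℝ) :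
    ∫ ω, g (X ω) ∂P = ∑ a, P.real (X ⁻¹' {a}) * g a := by
  have hν : IsProbabilityMeasure (P.map X) := Measure.isProbabilityMeasure_map hX.aemeasurable
  rw [← integral_map (φ := X) (f := g) hX.aemeasurable
    (measurable_of_finite g).aestronglyMeasurable, integral_fintype Integrable.of_finite]
  simp [map_measureReal_apply hX]

/-- Averaging over a uniform index that is independent of the past `X`. -/
lemma integral_sample {N : ℕ} {X : Ω → A} {ξ : Ω → Fin N} (hX : Measurable X) (hξ : Measurable ξ)
    (hu : ∀ j, P.real (ξ ⁻¹' {j}) = 1 / (N : ℝ)) (hi : IndepFun X ξ P) (F : A → Fin N → ℝ) :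
    ∫ ω, F (X ω) (ξ ω) ∂P = ∫ ω, (1 / (N : ℝ)) * ∑ j, F (X ω) j ∂P := by
  have := Fintype.ofFinite A
  rw [integral_comp_of_finite hX fun a => (1 / (N : ℝ)) * ∑ j, F a j,
    integral_comp_of_finite (hX.prodMk hξ) fun q => F q.1 q.2, Fintype.sum_prod_type]
  refine Finset.sum_congr rfl fun a _ => ?_
  rw [Finset.mul_sum, Finset.mul_sum]
  refine Finset.sum_congr rfl fun j _ => ?_
  have h1 : (fun ω => (X ω, ξ ω)) ⁻¹' {(a, j)} = X ⁻¹' {a} ∩ ξ ⁻¹' {j} := by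
    ext ω
    simp
  have h2 : P.real (X ⁻¹' {a} ∩ ξ ⁻¹' {j}) = P.real (X ⁻¹' {a}) * P.real (ξ ⁻¹' {j}) := by
    rw [measureReal_def, hi.measure_inter_preimage_eq_mul _ _ (measurableSet_singleton a)
      (measurableSet_singleton j), ENNReal.toReal_mul]
    rfl
  rw [h1, h2, hu]
  ring

end Sampling

/-! ### Deterministic estimates for one iteration. -/

section Pathwise

variable {n p : ℕ} {m : Fin n → ℕ} {f : (i : Fin n) → Fin (m i) → Vec p → ℝ} {μ L α : ℝ}
  {W : Matrix (Fin n) (Fin n) ℝ}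

/-- The next estimates; they do not depend on the indices drawn in the step. -/
noncomputable def nextX (W : Matrix (Fin n) (Fin n) ℝ) (α : ℝ) (S : State n p) : Fin n → Vec p :=
  fun i => (∑ r, W i r • S.x r) - α • S.y i

/-- Total squared error of the local SVRG gradients. -/
noncomputable def gradErr (f : (i : Fin n) → Fin (m i) → Vec p → ℝ) (S : State n p) : ℝ :=
  ∑ i, ‖S.v i - localGrad f S.x i‖ ^ 2

lemma innerStep_x (z : Fin n → Vec p) (s : (i : Fin n) → Fin (m i)) (S : State n p) :
    (innerStep W α f z s S).x = nextX W α S := rfl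

lemma innerStep_v_sub (z : Fin n → Vec p) (s : (i : Fin n) → Fin (m i)) (S : State n p)
    (i : Fin n) :
    (innerStep W α f z s S).v i - localGrad f (nextX W α S) i =
      gradient (f i (s i)) (nextX W α S i) - gradient (f i (s i)) (z i) -
        (gradient (localObj f i) (nextX W α S i) - gradient (localObj f i) (z i)) := by
  change gradient (f i (s i)) (nextX W α S i) - gradient (f i (s i)) (z i) +
    gradient (localObj f i) (z i) - gradient (localObj f i) (nextX W α S i) = _
  abel

/-- The invariant of gradient tracking: mixing preserves averages, so the increments `v' - v`
telescope. -/
lemma avg_innerStep (hW : W ∈ doublyStochastic ℝ (Fin n)) (z : Fin n → Vec p)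
    (s : (i : Fin n) → Fin (m i)) (S : State n p) (h : avg S.y = avg S.v) :
    avg (innerStep W α f z s S).y = avg (innerStep W α f z s S).v := by
  have e : (innerStep W α f z s S).y = fun i => (∑ r, W i r • S.y r) +
      (innerStep W α f z s S).v i - S.v i := rfl
  rw [e, avg_sub, avg_add, avg_mix hW, h]
  abel

lemma avg_nextX (hW : W ∈ doublyStochastic ℝ (Fin n)) (S : State n p) :
    avg (nextX W α S) = avg S.x - α • avg S.y := by
  unfold nextX
  rw [avg_sub, avg_mix hW, avg_smul]

lemma sum_inner_avg (hn : 0 < n) (e : Vec p) (d : Fin n → Vec p) :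
    ∑ i, inner ℝ e (d i) = n * inner ℝ e (avg d) := by
  rw [← inner_sum, ← smul_avg hn, real_inner_smul_right]

lemma errors_zero (xs : Vec p) (S : State n p) :
    errors xs S 0 = ∑ i, ‖S.x i - avg S.x‖ ^ 2 := rfl

lemma errors_one (xs : Vec p) (S : State n p) : errors xs S 1 = n * ‖avg S.x - xs‖ ^ 2 := rfl

lemma errors_two (xs : Vec p) (S : State n p) :
    errors xs S 2 = ∑ i, ‖S.y i - avg S.y‖ ^ 2 := rfl

lemma errors_nonneg (xs : Vec p) (S : State n p) (l : Fin 3) : 0 ≤ errors xs S l := by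
  have h0 : 0 ≤ errors xs S 0 := by rw [errors_zero]; positivity
  have h1 : 0 ≤ errors xs S 1 := by rw [errors_one]; positivity
  have h2 : 0 ≤ errors xs S 2 := by rw [errors_two]; positivity
  fin_cases l
  exacts [h0, h1, h2]

lemma sum_norm_sub_sq_eq_errors (hn : 0 < n) (xs : Vec p) (S : State n p) :
    ∑ i, ‖S.x i - xs‖ ^ 2 = errors xs S 0 + errors xs S 1 :=
  sum_norm_sub_sq hn _ _

lemma consensus_step (hn : 0 < n) (hW : W ∈ doublyStochastic ℝ (Fin n))
    (hσ : secondSingularValue W < 1) (z : Fin n → Vec p) (s : (i : Fin n) → Fin (m i)) (xs : Vec p)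
    (S : State n p) :
    errors xs (innerStep W α f z s S) 0 ≤
      (1 + secondSingularValue W ^ 2) / 2 * errors xs S 0 +
        2 * α ^ 2 / (1 - secondSingularValue W ^ 2) * errors xs S 2 := by
  have h := sum_norm_mix_add_sub_avg_sq_le hn hW hσ S.x fun i => (-α) • S.y i
  have e : nextX W α S = fun i => (∑ r, W i r • S.x r) + (-α) • S.y i := by
    funext i
    simp [nextX, sub_eq_add_neg]
  have e2 : ∀ i, ‖(-α) • S.y i - avg fun i => (-α) • S.y i‖ ^ 2 =
      α ^ 2 * ‖S.y i - avg S.y‖ ^ 2 := fun i => by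
    rw [avg_smul, ← smul_sub, norm_smul, mul_pow, Real.norm_eq_abs, sq_abs, neg_sq]
  simp only [e2, ← Finset.mul_sum] at h
  rw [errors_zero, innerStep_x, e, errors_zero, errors_two]
  refine h.trans (le_of_eq ?_)
  ring

/-- By the tracking invariant the average moves along the average of `v`, which is the average local
gradient plus noise. The cross term with the noise is kept exact because it vanishes in expectation.
-/
lemma optimality_step (hn : 0 < n) (hW : W ∈ doublyStochastic ℝ (Fin n)) (hμ : 0 < μ)
    (hα : 0 < α) (hμL : μ ≤ L) (hstep : 47 * (L ^ 2 * α) ≤ μ)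
    (hd : ∀ i j, Differentiable ℝ (f i j)) (hs : ∀ i, IsSmooth L (localObj f i))
    (hsg : IsSmooth L (globalObj f)) (hc : IsStronglyConvex μ (globalObj f)) {xs : Vec p}
    (hxs : gradient (globalObj f) xs = 0) (z : Fin n → Vec p) (s : (i : Fin n) → Fin (m i))
    (S : State n p) (hS : avg S.y = avg S.v) :
    errors xs (innerStep W α f z s S) 1 ≤
      (1 - 3 / 5 * (μ * α)) * errors xs S 1 + 3 / 2 * (L ^ 2 * α / μ) * errors xs S 0 +
        α ^ 2 * gradErr f S - 2 * α * ∑ i, inner ℝ (avg S.x - α • avg (localGrad f S.x) - xs)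
          (S.v i - localGrad f S.x i) := by
  have h1 := norm_avg_step_sq_le hn hμ hα hμL hstep hd hs hsg hc hxs S.x
  set e := avg S.x - α • avg (localGrad f S.x) - xs with he
  have h2 : avg (innerStep W α f z s S).x - xs =
      e - α • avg fun i => S.v i - localGrad f S.x i := by
    rw [innerStep_x, avg_nextX hW, hS, avg_sub, smul_sub, he]
    abel
  have h3 := norm_avg_sq_le hn fun i => S.v i - localGrad f S.x i
  rw [sum_inner_avg hn, errors_one, h2, norm_sub_sq_real, real_inner_smul_right, norm_smul,
    mul_pow, Real.norm_eq_abs, sq_abs]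
  rw [errors_one, errors_zero, gradErr]
  have h4 := mul_le_mul_of_nonneg_left h3 (sq_nonneg α)
  linarith

lemma sum_norm_avg_v_le (hn : 0 < n) (hd : ∀ i j, Differentiable ℝ (f i j))
    (hs : ∀ i, IsSmooth L (localObj f i)) {xs : Vec p} (hxs : gradient (globalObj f) xs = 0)
    (S : State n p) : n * ‖avg S.v‖ ^ 2 ≤
      2 * L ^ 2 * (errors xs S 0 + errors xs S 1) + 2 * gradErr f S := by
  have h1 := norm_avg_localGrad_sq_le hn hd hs hxs S.x
  have h2 := norm_avg_sq_le hn fun i => S.v i - localGrad f S.x i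
  rw [sum_norm_sub_sq_eq_errors hn] at h1
  rw [avg_sub] at h2
  have h3 := norm_add_sq_le one_pos (avg (localGrad f S.x)) (avg S.v - avg (localGrad f S.x))
  rw [add_sub_cancel] at h3
  have h4 := mul_le_mul_of_nonneg_left h3 (Nat.cast_nonneg (α := ℝ) n)
  rw [gradErr]
  linarith

/-- `W` fixes constant families, so the move is mixing minus identity applied to the disagreement
alone, minus `α y`; the mean part of `y` is that of `v`. -/
lemma displacement_le (hn : 0 < n) (hW : W ∈ doublyStochastic ℝ (Fin n))
    (hd : ∀ i j, Differentiable ℝ (f i j)) (hs : ∀ i, IsSmooth L (localObj f i)) {xs : Vec p}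
    (hxs : gradient (globalObj f) xs = 0) (S : State n p) (hS : avg S.y = avg S.v) :
    ∑ i, ‖nextX W α S i - S.x i‖ ^ 2 ≤ 8 * errors xs S 0 + 2 * α ^ 2 * (errors xs S 2 +
      2 * L ^ 2 * (errors xs S 0 + errors xs S 1) + 2 * gradErr f S) := by
  have hrow : ∀ i, ∑ r, W i r • avg S.x = avg S.x := fun i => by
    rw [← Finset.sum_smul, sum_row_of_mem_doublyStochastic hW, one_smul]
  have hsplit : ∀ i, nextX W α S i - S.x i = ((∑ r, W i r • (S.x r - avg S.x)) +
      -(S.x i - avg S.x)) + (-α) • S.y i := fun i => by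
    simp only [nextX, smul_sub, Finset.sum_sub_distrib, hrow, neg_smul]
    abel
  have h1 := sum_norm_add_sq_le one_pos (fun i => (∑ r, W i r • (S.x r - avg S.x)) +
      -(S.x i - avg S.x)) fun i => (-α) • S.y i
  have h2 := sum_norm_add_sq_le one_pos (fun i => ∑ r, W i r • (S.x r - avg S.x))
    fun i => -(S.x i - avg S.x)
  have h3 := sum_norm_sq_mix_le hW fun i => S.x i - avg S.x
  have h4 : ∑ i, ‖S.y i‖ ^ 2 = errors xs S 2 + n * ‖avg S.v‖ ^ 2 := by
    have := sum_norm_sub_sq hn S.y 0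
    simp only [sub_zero] at this
    rw [this, hS, errors_two, hS]
  have h5 := sum_norm_avg_v_le hn hd hs hxs S
  simp only [norm_neg] at h2
  simp only [norm_smul, mul_pow, Real.norm_eq_abs, sq_abs, neg_sq, ← Finset.mul_sum, h4] at h1
  simp only [hsplit]
  rw [errors_zero] at *
  have h6 := mul_le_mul_of_nonneg_left h5 (sq_nonneg α)
  linarith

lemma tracking_step (hn : 0 < n) (hW : W ∈ doublyStochastic ℝ (Fin n))
    (hσ : secondSingularValue W < 1) (z : Fin n → Vec p) (s : (i : Fin n) → Fin (m i)) (xs : Vec p)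
    (S : State n p) :
    errors xs (innerStep W α f z s S) 2 ≤
      (1 + secondSingularValue W ^ 2) / 2 * errors xs S 2 +
        2 / (1 - secondSingularValue W ^ 2) *
          ∑ i, ‖(innerStep W α f z s S).v i - S.v i‖ ^ 2 := by
  have h := sum_norm_mix_add_sub_avg_sq_le hn hW hσ S.y fun i =>
    (innerStep W α f z s S).v i - S.v i
  have e : (innerStep W α f z s S).y = fun i => (∑ r, W i r • S.y r) +
      ((innerStep W α f z s S).v i - S.v i) := by
    funext i
    rw [← add_sub_assoc]
    rfl
  rw [errors_two, e, errors_two]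
  refine h.trans ?_
  have hs : 0 < 1 - secondSingularValue W ^ 2 := by
    nlinarith [secondSingularValue_nonneg W]
  gcongr _ + _ * ?_
  exact sum_norm_sub_avg_sq_le hn _

/-- Expands the square around the new local gradient: the deviation of the new `v` from it has mean
zero given the past, so the inner-product term will disappear. -/
lemma sum_norm_v_sub_sq_le (hs : ∀ i, IsSmooth L (localObj f i)) (z : Fin n → Vec p)
    (s : (i : Fin n) → Fin (m i)) (S : State n p) :
    ∑ i, ‖(innerStep W α f z s S).v i - S.v i‖ ^ 2 ≤
      2 * L ^ 2 * ∑ i, ‖nextX W α S i - S.x i‖ ^ 2 + 2 * gradErr f S +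
        gradErr f (innerStep W α f z s S) +
        2 * ∑ i, inner ℝ (localGrad f (nextX W α S) i - S.v i)
          ((innerStep W α f z s S).v i - localGrad f (nextX W α S) i) := by
  set S' := innerStep W α f z s S with hS'
  set g' := localGrad f (nextX W α S) with hg'
  have h1 : ∀ i, ‖S'.v i - S.v i‖ ^ 2 = ‖g' i - S.v i‖ ^ 2 +
      2 * inner ℝ (g' i - S.v i) (S'.v i - g' i) + ‖S'.v i - g' i‖ ^ 2 := fun i => by
    rw [← norm_add_sq_real, add_comm (g' i - S.v i), sub_add_sub_cancel]
  have h2 := sum_norm_add_sq_le one_pos (fun i => g' i - localGrad f S.x i)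
    fun i => -(S.v i - localGrad f S.x i)
  have h3 := sum_norm_localGrad_sub_sq_le hs (nextX W α S) S.x
  have h4 : ∀ i, g' i - localGrad f S.x i + -(S.v i - localGrad f S.x i) = g' i - S.v i :=
    fun i => by abel
  simp only [h4, norm_neg] at h2
  simp only [h1, Finset.sum_add_distrib, ← Finset.mul_sum]
  have h5 : gradErr f S' = ∑ i, ‖S'.v i - g' i‖ ^ 2 := rfl
  have h6 : gradErr f S = ∑ i, ‖S.v i - localGrad f S.x i‖ ^ 2 := rfl
  linarith

lemma sum_norm_sub_sub_sq_le {V : Type*} [NormedAddCommGroup V] [InnerProductSpace ℝ V]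
    (x z b : Fin n → V) :
    ∑ i, ‖x i - z i‖ ^ 2 ≤ 2 * ∑ i, ‖x i - b i‖ ^ 2 + 2 * ∑ i, ‖z i - b i‖ ^ 2 := by
  have h2 := sum_norm_add_sq_le one_pos (fun i => x i - b i) fun i => -(z i - b i)
  have h4 : ∀ i, x i - b i + -(z i - b i) = x i - z i := fun i => by abel
  simp only [h4, norm_neg] at h2
  linarith

end Pathwise

end GTSVRG

namespace GTSVRG

/-! ### Integrating linear inequalities. -/

section Linear

variable {Ω : Type*} [MeasurableSpace Ω] {P : Measure Ω} {g g₁ g₂ g₃ g₄ g₅ : Ω → ℝ}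

lemma integral_le_two_terms (a₁ a₂ : ℝ) (hg : Integrable g P) (h₁ : Integrable g₁ P)
    (h₂ : Integrable g₂ P) (h : ∀ ω, g ω ≤ a₁ * g₁ ω + a₂ * g₂ ω) :
    ∫ ω, g ω ∂P ≤ a₁ * ∫ ω, g₁ ω ∂P + a₂ * ∫ ω, g₂ ω ∂P := by
  refine (integral_mono (g := fun ω => a₁ * g₁ ω + a₂ * g₂ ω) hg (by fun_prop) h).trans_eq ?_
  rw [integral_add (by fun_prop) (by fun_prop), integral_const_mul, integral_const_mul]

lemma integral_le_four_terms (a₁ a₂ a₃ a₄ : ℝ) (hg : Integrable g P) (h₁ : Integrable g₁ P)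
    (h₂ : Integrable g₂ P) (h₃ : Integrable g₃ P) (h₄ : Integrable g₄ P)
    (h : ∀ ω, g ω ≤ a₁ * g₁ ω + a₂ * g₂ ω + a₃ * g₃ ω + a₄ * g₄ ω) :
    ∫ ω, g ω ∂P ≤ a₁ * ∫ ω, g₁ ω ∂P + a₂ * ∫ ω, g₂ ω ∂P + a₃ * ∫ ω, g₃ ω ∂P +
      a₄ * ∫ ω, g₄ ω ∂P := by
  refine (integral_mono (g := fun ω => a₁ * g₁ ω + a₂ * g₂ ω + a₃ * g₃ ω + a₄ * g₄ ω) hg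
    (by fun_prop) h).trans_eq ?_
  rw [integral_add (by fun_prop) (by fun_prop), integral_add (by fun_prop) (by fun_prop),
    integral_add (by fun_prop) (by fun_prop)]
  simp only [integral_const_mul]

lemma integral_le_five_terms (a₁ a₂ a₃ a₄ a₅ : ℝ) (hg : Integrable g P) (h₁ : Integrable g₁ P)
    (h₂ : Integrable g₂ P) (h₃ : Integrable g₃ P) (h₄ : Integrable g₄ P) (h₅ : Integrable g₅ P)
    (h : ∀ ω, g ω ≤ a₁ * g₁ ω + a₂ * g₂ ω + a₃ * g₃ ω + a₄ * g₄ ω + a₅ * g₅ ω) :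
    ∫ ω, g ω ∂P ≤ a₁ * ∫ ω, g₁ ω ∂P + a₂ * ∫ ω, g₂ ω ∂P + a₃ * ∫ ω, g₃ ω ∂P +
      a₄ * ∫ ω, g₄ ω ∂P + a₅ * ∫ ω, g₅ ω ∂P := by
  refine (integral_mono (g := fun ω => a₁ * g₁ ω + a₂ * g₂ ω + a₃ * g₃ ω + a₄ * g₄ ω + a₅ * g₅ ω)
    hg (by fun_prop) h).trans_eq ?_
  rw [integral_add (by fun_prop) (by fun_prop), integral_add (by fun_prop) (by fun_prop),
    integral_add (by fun_prop) (by fun_prop), integral_add (by fun_prop) (by fun_prop)]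
  simp only [integral_const_mul]

end Linear

section Arithmetic

/-! Scalar bookkeeping: the bounds satisfied by the mean squared errors `x`, `u`, `y`, the gradient
variances `V`, `V'`, the displacement `D` and the errors `ρ`, `ζ` of the reference points are
dominated by `G_α` applied to the weights. -/

variable {μ L σ α x u y V V' D ρ ζ a b d : ℝ}

lemma optimality_weight_le (hμ : 0 < μ) (hα : 0 < α) (hμL : μ ≤ L) (hstep : 47 * (L ^ 2 * α) ≤ μ)
    (ha : 0 ≤ a) (hb : 0 ≤ b) (hx : x ≤ a) (hu : u ≤ b) (hV : V ≤ 4 * L ^ 2 * (a + b)) :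
    (1 - 3 / 5 * (μ * α)) * u + 3 / 2 * (L ^ 2 * α / μ) * x + α ^ 2 * V ≤
      2 * L ^ 2 * α / μ * a + (1 - μ * α / 2) * b := by
  obtain ⟨hs1, hs2⟩ := step_size_consequences hμ hα hμL hstep
  have t1 := mul_le_mul_of_nonneg_left hu (show 0 ≤ 1 - 3 / 5 * (μ * α) by linarith)
  have t0 := mul_le_mul_of_nonneg_left hx (show 0 ≤ 3 / 2 * (L ^ 2 * α / μ) by positivity)
  have t3 := mul_le_mul_of_nonneg_left hV (sq_nonneg α)
  have k1 : 4 * (L ^ 2 * α ^ 2) * b ≤ 1 / 10 * (μ * α) * b :=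
    mul_le_mul_of_nonneg_right (by linarith [mul_pos hμ hα]) hb
  have k0 : 4 * (L ^ 2 * α ^ 2) * a ≤ 1 / 2 * (L ^ 2 * α / μ) * a := by
    refine mul_le_mul_of_nonneg_right ?_ ha
    rw [← mul_div_assoc, le_div_iff₀ hμ]
    have : L ^ 2 * α * (8 * (μ * α)) ≤ L ^ 2 * α * 1 := by gcongr; linarith
    linarith
  have e : 2 * L ^ 2 * α / μ = 2 * (L ^ 2 * α / μ) := by ring
  rw [e]
  linarith

lemma tracking_weight_le (hμ : 0 < μ) (hα : 0 < α) (hμL : μ ≤ L) (hstep : 47 * (L ^ 2 * α) ≤ μ)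
    (hσ : 0 < 1 - σ ^ 2) (ha : 0 ≤ a) (hb : 0 ≤ b) (hd : 0 ≤ d) (hx : x ≤ a) (hu : u ≤ b)
    (hy : y ≤ d) (hζ : ζ ≤ a + b) (hV : V ≤ 4 * L ^ 2 * (a + b))
    (hD : D ≤ 8 * x + 2 * α ^ 2 * (y + 2 * L ^ 2 * (x + u) + 2 * V))
    (hV' : V' ≤ L ^ 2 * (2 * D + 4 * (x + u) + 4 * ζ)) :
    (1 + σ ^ 2) / 2 * y + 2 / (1 - σ ^ 2) * (2 * L ^ 2 * D + 2 * V + V') ≤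
      100 * L ^ 2 / (1 - σ ^ 2) * a + 70 * L ^ 2 / (1 - σ ^ 2) * b +
        ((1 + σ ^ 2) / 2 + 40 * L ^ 2 * α ^ 2 / (1 - σ ^ 2)) * d := by
  obtain ⟨hs1, hs2⟩ := step_size_consequences hμ hα hμL hstep
  -- The two consequences combine to `47² L² α² ≤ 1`, and `47² = 2209`; below, `20 / 2209 < 1 /
  -- 100`.
  have hLα : L ^ 2 * α ^ 2 ≤ 1 / 2209 := by linarith
  have t2 := mul_le_mul_of_nonneg_left hy (show 0 ≤ (1 + σ ^ 2) / 2 by positivity)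
  have bD : D ≤ 8 * a + 2 * α ^ 2 * d + 1 / 100 * (a + b) := by
    have h1 : 2 * L ^ 2 * (x + u) ≤ 2 * L ^ 2 * (a + b) :=
      mul_le_mul_of_nonneg_left (by linarith) (by positivity)
    have h2 : 2 * α ^ 2 * (y + 2 * L ^ 2 * (x + u) + 2 * V) ≤
        2 * α ^ 2 * (d + 10 * L ^ 2 * (a + b)) :=
      mul_le_mul_of_nonneg_left (by linarith) (by positivity)
    have h3 : L ^ 2 * α ^ 2 * (a + b) ≤ 1 / 2209 * (a + b) :=
      mul_le_mul_of_nonneg_right hLα (by positivity)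
    linarith
  have key : 2 * L ^ 2 * D + 2 * V + V' ≤ L ^ 2 * (50 * a + 35 * b + 20 * α ^ 2 * d) := by
    have h1 : 2 * L ^ 2 * D + 2 * V + V' ≤
        L ^ 2 * (4 * D + 8 * (a + b) + 4 * (x + u) + 4 * ζ) := by linarith
    refine h1.trans (mul_le_mul_of_nonneg_left ?_ (sq_nonneg L))
    have : 0 ≤ α ^ 2 * d := by positivity
    linarith
  have k2 := mul_le_mul_of_nonneg_left key (show 0 ≤ 2 / (1 - σ ^ 2) by positivity)
  have e : 100 * L ^ 2 / (1 - σ ^ 2) * a + 70 * L ^ 2 / (1 - σ ^ 2) * b +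
      ((1 + σ ^ 2) / 2 + 40 * L ^ 2 * α ^ 2 / (1 - σ ^ 2)) * d =
      (1 + σ ^ 2) / 2 * d + 2 / (1 - σ ^ 2) *
        (L ^ 2 * (50 * a + 35 * b + 20 * α ^ 2 * d)) := by ring
  rw [e]
  linarith

end Arithmetic

/-! ### One iteration in expectation. -/

section OneStep

variable {Ω : Type*} [MeasurableSpace Ω] {P : Measure Ω} [IsProbabilityMeasure P]
  {n p : ℕ} {m : Fin n → ℕ} {f : (i : Fin n) → Fin (m i) → Vec p → ℝ} {μ L α c γ : ℝ}
  {W : Matrix (Fin n) (Fin n) ℝ} {xs : Vec p} {w : Fin 3 → ℝ}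

/-- What an iteration of the inner loop needs to know about the random state `S`, whose gradients
`v` were computed with the reference point `r`: the gradients are unbiased given the estimates,
with controlled variance, and the mean squared errors are at most `c` times the weights `w`. -/
structure MeanBound (P : Measure Ω) (f : (i : Fin n) → Fin (m i) → Vec p → ℝ) (L : ℝ) (xs : Vec p)
    (w : Fin 3 → ℝ) (c : ℝ) (S : Ω → State n p) (r : Ω → Fin n → Vec p) : Prop where
  avg_eq : ∀ ω, avg (S ω).y = avg (S ω).v
  unbiased : ∀ (h : (Fin n → Vec p) → Vec p) (i : Fin n),
    ∫ ω, inner ℝ (h (S ω).x) ((S ω).v i - localGrad f (S ω).x i) ∂P = 0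
  variance : ∫ ω, gradErr f (S ω) ∂P ≤ L ^ 2 * ∫ ω, ∑ i, ‖(S ω).x i - r ω i‖ ^ 2 ∂P
  error_le : ∀ l, ∫ ω, errors xs (S ω) l ∂P ≤ c * w l
  ref_le : ∫ ω, ∑ i, ‖r ω i - xs‖ ^ 2 ∂P ≤ c * (w 0 + w 1)

variable {A : Type*} [Finite A] [MeasurableSpace A] [DiscreteMeasurableSpace A]
  {X : Ω → A} {ξ : (i : Fin n) → Ω → Fin (m i)} {S : A → State n p} {r z : A → Fin n → Vec p}

/-- The new gradient errors are orthogonal to the past. -/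
lemma integral_inner_innerStep (hm : ∀ i, 0 < m i) (hd : ∀ i j, Differentiable ℝ (f i j))
    (hX : Measurable X) (hξ : ∀ i, Measurable (ξ i))
    (hu : ∀ i j, P.real (ξ i ⁻¹' {j}) = 1 / (m i : ℝ)) (hi : ∀ i, IndepFun X (ξ i) P)
    (h : A → Vec p) (i : Fin n) :
    ∫ ω, inner ℝ (h (X ω)) ((innerStep W α f (z (X ω)) (fun i => ξ i ω) (S (X ω))).v i -
      localGrad f (nextX W α (S (X ω))) i) ∂P = 0 := by
  simp only [innerStep_v_sub]
  rw [integral_sample hX (hξ i) (hu i) (hi i) fun a j => inner ℝ (h a)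
    (gradient (f i j) (nextX W α (S a) i) - gradient (f i j) (z a i) -
      (gradient (localObj f i) (nextX W α (S a) i) - gradient (localObj f i) (z a i)))]
  refine integral_eq_zero_of_ae (Filter.Eventually.of_forall fun ω => ?_)
  have hmi : (m i : ℝ) ≠ 0 := by have := hm i; positivity
  simp only [← inner_sum, Finset.sum_sub_distrib, gradient_localObj hd, Finset.sum_const,
    Finset.card_univ, Fintype.card_fin, ← Nat.cast_smul_eq_nsmul ℝ, ← smul_sub, smul_smul,
    mul_one_div_cancel hmi, one_smul, sub_self, inner_zero_right, mul_zero, Pi.zero_apply]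

/-- Conditional variance of the new gradients. -/
lemma integral_gradErr_innerStep_le (hm : ∀ i, 0 < m i) (hd : ∀ i j, Differentiable ℝ (f i j))
    (hs : ∀ i j, IsSmooth L (f i j)) (hX : Measurable X) (hξ : ∀ i, Measurable (ξ i))
    (hu : ∀ i j, P.real (ξ i ⁻¹' {j}) = 1 / (m i : ℝ)) (hi : ∀ i, IndepFun X (ξ i) P) :
    ∫ ω, gradErr f (innerStep W α f (z (X ω)) (fun i => ξ i ω) (S (X ω))) ∂P ≤
      L ^ 2 * ∫ ω, ∑ i, ‖nextX W α (S (X ω)) i - z (X ω) i‖ ^ 2 ∂P := by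
  simp only [gradErr, innerStep_x, innerStep_v_sub]
  rw [integral_finsetSum _ fun i _ => integrable_comp_of_finite (hX.prodMk (hξ i)) fun q : A × _ =>
      ‖gradient (f i q.2) (nextX W α (S q.1) i) - gradient (f i q.2) (z q.1 i) -
        (gradient (localObj f i) (nextX W α (S q.1) i) - gradient (localObj f i) (z q.1 i))‖ ^ 2,
    integral_finsetSum _ fun i _ => integrable_comp_of_finite hX fun a =>
      ‖nextX W α (S a) i - z a i‖ ^ 2, Finset.mul_sum]
  refine Finset.sum_le_sum fun i _ => ?_
  rw [integral_sample hX (hξ i) (hu i) (hi i) fun a j =>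
    ‖gradient (f i j) (nextX W α (S a) i) - gradient (f i j) (z a i) -
      (gradient (localObj f i) (nextX W α (S a) i) - gradient (localObj f i) (z a i))‖ ^ 2,
    ← integral_const_mul]
  refine integral_mono (integrable_comp_of_finite hX fun a => 1 / (m i : ℝ) * ∑ j,
    ‖gradient (f i j) (nextX W α (S a) i) - gradient (f i j) (z a i) -
      (gradient (localObj f i) (nextX W α (S a) i) - gradient (localObj f i) (z a i))‖ ^ 2)
    (integrable_comp_of_finite hX fun a => L ^ 2 * ‖nextX W α (S a) i - z a i‖ ^ 2) fun ω => ?_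
  set x' := nextX W α (S (X ω)) i
  set z' := z (X ω) i
  have hmi : (0 : ℝ) < m i := by have := hm i; positivity
  -- The local gradient difference is the mean over the samples, so the variance is bounded by the
  -- second moment; `avg` runs here over samples, not nodes.
  have h1 : gradient (localObj f i) x' - gradient (localObj f i) z' =
      avg fun j => gradient (f i j) x' - gradient (f i j) z' := by
    rw [avg_sub, gradient_localObj hd, gradient_localObj hd]
    rfl
  have h2 := sum_norm_sub_avg_sq_le (hm i) fun j => gradient (f i j) x' - gradient (f i j) z'
  have h3 : ∑ j, ‖gradient (f i j) x' - gradient (f i j) z'‖ ^ 2 ≤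
      m i * (L ^ 2 * ‖x' - z'‖ ^ 2) := by
    have := Finset.sum_le_sum fun j (_ : j ∈ Finset.univ) => (hs i j).sq x' z'
    simpa using this
  simp only [h1]
  rw [one_div, inv_mul_le_iff₀ hmi]
  exact h2.trans h3

/-- Mean squared errors after one iteration of the inner loop, in terms of those before. -/
lemma MeanBound.errors_innerStep_le (hn : 0 < n) (hm : ∀ i, 0 < m i)
    (hW : W ∈ doublyStochastic ℝ (Fin n))
    (hσ : secondSingularValue W < 1) (hμ : 0 < μ) (hα : 0 < α) (hμL : μ ≤ L)
    (hstep : 47 * (L ^ 2 * α) ≤ μ) (hd : ∀ i j, Differentiable ℝ (f i j))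
    (hsc : ∀ i j, IsStronglyConvex μ (f i j)) (hs : ∀ i j, IsSmooth L (f i j))
    (hxs : gradient (globalObj f) xs = 0) (hw : ∀ l, 0 ≤ w l) (hc : 0 ≤ c)
    (hX : Measurable X) (hξ : ∀ i, Measurable (ξ i))
    (hu : ∀ i j, P.real (ξ i ⁻¹' {j}) = 1 / (m i : ℝ)) (hi : ∀ i, IndepFun X (ξ i) P)
    (hS : MeanBound P f L xs w c (fun ω => S (X ω)) (fun ω => r (X ω)))
    (hz : ∫ ω, ∑ i, ‖z (X ω) i - xs‖ ^ 2 ∂P ≤ c * (w 0 + w 1)) (l : Fin 3) :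
    ∫ ω, errors xs (innerStep W α f (z (X ω)) (fun i => ξ i ω) (S (X ω))) l ∂P ≤
      c * (matG μ L (secondSingularValue W) α).mulVec w l := by
  have hsl := isSmooth_localObj hm hd hs
  have hσ0 : 0 ≤ secondSingularValue W := secondSingularValue_nonneg W
  have hσs : 0 < 1 - secondSingularValue W ^ 2 := by nlinarith
  have IA : ∀ g : A → ℝ, Integrable (fun ω => g (X ω)) P := integrable_comp_of_finite hX
  have IB : ∀ g : A → ((i : Fin n) → Fin (m i)) → ℝ,
      Integrable (fun ω => g (X ω) fun i => ξ i ω) P := fun g =>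
    integrable_comp_of_finite (hX.prodMk (measurable_pi_lambda _ hξ)) fun q => g q.1 q.2
  have IS' : ∀ g : State n p → ℝ,
      Integrable (fun ω => g (innerStep W α f (z (X ω)) (fun i => ξ i ω) (S (X ω)))) P := fun g =>
    IB fun a s => g (innerStep W α f (z a) s (S a))
  have i0 := IA fun a => errors xs (S a) 0
  have i1 := IA fun a => errors xs (S a) 1
  have i2 := IA fun a => errors xs (S a) 2
  have iV := IA fun a => gradErr f (S a)
  have iD := IA fun a => ∑ i, ‖nextX W α (S a) i - (S a).x i‖ ^ 2
  have iζ := IA fun a => ∑ i, ‖z a i - xs‖ ^ 2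
  have c0 : 0 ≤ c * w 0 := mul_nonneg hc (hw 0)
  have c1 : 0 ≤ c * w 1 := mul_nonneg hc (hw 1)
  have c2 : 0 ≤ c * w 2 := mul_nonneg hc (hw 2)
  have bx := hS.error_le 0
  have bu := hS.error_le 1
  have by' := hS.error_le 2
  -- The distance to the old reference point is split through the minimizer; both halves are at most
  -- `c (w 0 + w 1)`. This is where the old reference point enters. The zero coefficient pads an
  -- unneeded fourth term.
  have bV : ∫ ω, gradErr f (S (X ω)) ∂P ≤ 4 * L ^ 2 * (c * w 0 + c * w 1) := by
    have h1 := integral_le_four_terms 2 2 2 0 (IA fun a => ∑ i, ‖(S a).x i - r a i‖ ^ 2) i0 i1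
      (IA fun a => ∑ i, ‖r a i - xs‖ ^ 2) i0 fun ω => by
        have := sum_norm_sub_sub_sq_le (S (X ω)).x (r (X ω)) fun _ => xs
        rw [sum_norm_sub_sq_eq_errors hn] at this
        linarith
    have h2 := mul_le_mul_of_nonneg_left h1 (sq_nonneg L)
    have h3 := mul_le_mul_of_nonneg_left
      (add_le_add (add_le_add bx bu) hS.ref_le) (show 0 ≤ 2 * L ^ 2 by positivity)
    linarith [hS.variance]
  have bD := integral_le_four_terms (8 + 4 * α ^ 2 * L ^ 2) (4 * α ^ 2 * L ^ 2) (2 * α ^ 2)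
    (4 * α ^ 2) iD i0 i1 i2 iV fun ω => by
      have := displacement_le (α := α) hn hW hd hsl hxs _ (hS.avg_eq ω)
      linarith
  have bV' : ∫ ω, gradErr f (innerStep W α f (z (X ω)) (fun i => ξ i ω) (S (X ω))) ∂P ≤ _ :=
    (integral_gradErr_innerStep_le hm hd hs hX hξ hu hi).trans (mul_le_mul_of_nonneg_left
      (integral_le_four_terms 2 4 4 4 (IA fun a => ∑ i, ‖nextX W α (S a) i - z a i‖ ^ 2)
        iD i0 i1 iζ fun ω => by
          have h1 := sum_norm_sub_sub_sq_le (nextX W α (S (X ω))) (z (X ω)) (S (X ω)).x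
          have h2 := sum_norm_sub_sub_sq_le (z (X ω)) (S (X ω)).x fun _ => xs
          rw [sum_norm_sub_sq_eq_errors hn] at h2
          linarith) (sq_nonneg L))
  have e0 : ∫ ω, errors xs (innerStep W α f (z (X ω)) (fun i => ξ i ω) (S (X ω))) 0 ∂P ≤
      c * (matG μ L (secondSingularValue W) α).mulVec w 0 := by
    refine (integral_le_two_terms _ _ (IS' fun s => errors xs s 0) i0 i2
      fun ω => consensus_step hn hW hσ _ _ xs _).trans ?_
    rw [matG_mulVec_zero]
    have t0 := mul_le_mul_of_nonneg_left bx
      (show 0 ≤ (1 + secondSingularValue W ^ 2) / 2 by positivity)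
    have t2 := mul_le_mul_of_nonneg_left by'
      (show 0 ≤ 2 * α ^ 2 / (1 - secondSingularValue W ^ 2) by positivity)
    linarith
  have e1 : ∫ ω, errors xs (innerStep W α f (z (X ω)) (fun i => ξ i ω) (S (X ω))) 1 ∂P ≤
      c * (matG μ L (secondSingularValue W) α).mulVec w 1 := by
    have hin : ∀ i, Integrable (fun ω => inner ℝ
        (avg (S (X ω)).x - α • avg (localGrad f (S (X ω)).x) - xs)
        ((S (X ω)).v i - localGrad f (S (X ω)).x i)) P := fun i =>
      IA fun a => inner ℝ (avg (S a).x - α • avg (localGrad f (S a).x) - xs)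
        ((S a).v i - localGrad f (S a).x i)
    -- The first argument is a function of the current estimates only, which is all that `unbiased`
    -- allows.
    have hzero : ∫ ω, ∑ i, inner ℝ (avg (S (X ω)).x - α • avg (localGrad f (S (X ω)).x) - xs)
        ((S (X ω)).v i - localGrad f (S (X ω)).x i) ∂P = 0 := by
      rw [integral_finsetSum _ fun i _ => hin i]
      exact Finset.sum_eq_zero fun i _ =>
        hS.unbiased (fun b => avg b - α • avg (localGrad f b) - xs) i
    have h := integral_le_four_terms (1 - 3 / 5 * (μ * α)) (3 / 2 * (L ^ 2 * α / μ)) (α ^ 2)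
      (-(2 * α)) (IS' fun s => errors xs s 1) i1 i0 iV
      (integrable_finsetSum Finset.univ fun i _ => hin i) fun ω => by
        have := optimality_step hn hW hμ hα hμL hstep hd hsl (isSmooth_globalObj hn hm hd hs)
          (isStronglyConvex_globalObj hn hm hd hsc) hxs (z (X ω)) (fun i => ξ i ω) _ (hS.avg_eq ω)
        linarith
    rw [hzero, mul_zero, add_zero] at h
    refine (h.trans (optimality_weight_le hμ hα hμL hstep c0 c1 bx bu bV)).trans_eq ?_
    rw [matG_mulVec_one]
    ring
  have e2 : ∫ ω, errors xs (innerStep W α f (z (X ω)) (fun i => ξ i ω) (S (X ω))) 2 ∂P ≤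
      c * (matG μ L (secondSingularValue W) α).mulVec w 2 := by
    have hin : ∀ i, Integrable (fun ω => inner ℝ
        (localGrad f (nextX W α (S (X ω))) i - (S (X ω)).v i)
        ((innerStep W α f (z (X ω)) (fun i => ξ i ω) (S (X ω))).v i -
          localGrad f (nextX W α (S (X ω))) i)) P := fun i =>
      IB fun a s => inner ℝ (localGrad f (nextX W α (S a)) i - (S a).v i)
        ((innerStep W α f (z a) s (S a)).v i - localGrad f (nextX W α (S a)) i)
    -- Here the first argument also involves the current `v`; independence of the new draw from the
    -- entire past is what is needed.
    have hzero : ∫ ω, ∑ i, inner ℝ (localGrad f (nextX W α (S (X ω))) i - (S (X ω)).v i)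
        ((innerStep W α f (z (X ω)) (fun i => ξ i ω) (S (X ω))).v i -
          localGrad f (nextX W α (S (X ω))) i) ∂P = 0 := by
      rw [integral_finsetSum _ fun i _ => hin i]
      exact Finset.sum_eq_zero fun i _ => integral_inner_innerStep hm hd hX hξ hu hi
        (fun a => localGrad f (nextX W α (S a)) i - (S a).v i) i
    set κ := 2 / (1 - secondSingularValue W ^ 2) with hκ
    have h := integral_le_five_terms ((1 + secondSingularValue W ^ 2) / 2) (κ * (2 * L ^ 2))
      (κ * 2) κ (κ * 2) (IS' fun s => errors xs s 2) i2 iD iV (IS' fun s => gradErr f s)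
      (integrable_finsetSum Finset.univ fun i _ => hin i) fun ω => by
        have h1 := tracking_step (f := f) (α := α) hn hW hσ (z (X ω)) (fun i => ξ i ω) xs (S (X ω))
        have h2 := mul_le_mul_of_nonneg_left
          (sum_norm_v_sub_sq_le (W := W) (α := α) hsl (z (X ω)) (fun i => ξ i ω) (S (X ω)))
          (show 0 ≤ κ by positivity)
        linarith
    rw [hzero, mul_zero, add_zero] at h
    have h' := tracking_weight_le hμ hα hμL hstep hσs c0 c1 c2 bx bu by'
      (hz.trans_eq (mul_add _ _ _)) bV (bD.trans_eq (by ring)) (bV'.trans_eq (by ring))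
    rw [matG_mulVec_two]
    linarith
  fin_cases l
  exacts [e0, e1, e2]

/-- One iteration of the inner loop contracts the bound on the mean squared errors. -/
lemma MeanBound.step (hn : 0 < n) (hm : ∀ i, 0 < m i) (hW : W ∈ doublyStochastic ℝ (Fin n))
    (hσ : secondSingularValue W < 1) (hμ : 0 < μ) (hα : 0 < α) (hμL : μ ≤ L)
    (hstep : 47 * (L ^ 2 * α) ≤ μ) (hd : ∀ i j, Differentiable ℝ (f i j))
    (hsc : ∀ i j, IsStronglyConvex μ (f i j)) (hs : ∀ i j, IsSmooth L (f i j))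
    (hxs : gradient (globalObj f) xs = 0) (hw : ∀ l, 0 ≤ w l) (hc : 0 ≤ c)
    (hG : ∀ l, (matG μ L (secondSingularValue W) α).mulVec w l ≤ γ * w l)
    (hX : Measurable X) (hξ : ∀ i, Measurable (ξ i))
    (hu : ∀ i j, P.real (ξ i ⁻¹' {j}) = 1 / (m i : ℝ)) (hi : ∀ i, IndepFun X (ξ i) P)
    (hS : MeanBound P f L xs w c (fun ω => S (X ω)) (fun ω => r (X ω)))
    {c' : ℝ} (hcc : γ * c ≤ c') (hcc' : c' ≤ c)
    (hz : ∫ ω, ∑ i, ‖z (X ω) i - xs‖ ^ 2 ∂P ≤ c' * (w 0 + w 1)) :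
    MeanBound P f L xs w c'
      (fun ω => innerStep W α f (z (X ω)) (fun i => ξ i ω) (S (X ω))) (fun ω => z (X ω)) where
  avg_eq ω := avg_innerStep hW _ _ _ (hS.avg_eq ω)
  unbiased h i := integral_inner_innerStep hm hd hX hξ hu hi (fun a => h (nextX W α (S a))) i
  variance := integral_gradErr_innerStep_le hm hd hs hX hξ hu hi
  error_le l := by
    have hz' := hz.trans (mul_le_mul_of_nonneg_right hcc' (add_nonneg (hw 0) (hw 1)))
    refine (hS.errors_innerStep_le hn hm hW hσ hμ hα hμL hstep hd hsc hs hxs hw hc hX hξ hu hi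
      hz' l).trans ((mul_le_mul_of_nonneg_left (hG l) hc).trans ?_)
    rw [← mul_assoc, mul_comm c]
    exact mul_le_mul_of_nonneg_right hcc (hw l)
  ref_le := hz

end OneStep

end GTSVRG

namespace GTSVRG

/-! ### Dependence of the state on finitely many past draws. -/

section Past

variable {n p : ℕ} {m : Fin n → ℕ} {f : (i : Fin n) → Fin (m i) → Vec p → ℝ} {α : ℝ}
  {W : Matrix (Fin n) (Fin n) ℝ} {K : ℕ} {x₀ : Fin n → Vec p}

/-- The state after `k` iterations of the inner loop of outer iteration `t`. -/
noncomputable def loopState (W : Matrix (Fin n) (Fin n) ℝ) (α : ℝ)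
    (f : (i : Fin n) → Fin (m i) → Vec p → ℝ) (K : ℕ) (x₀ : Fin n → Vec p)
    (s : ℕ → ℕ → (i : Fin n) → Fin (m i)) (t k : ℕ) : State n p :=
  innerLoop W α f (s t) (outerLoop W α f K x₀ s t) k

lemma innerLoop_congr {s s' : ℕ → (i : Fin n) → Fin (m i)} (S : State n p) {k : ℕ}
    (h : ∀ j < k, s j = s' j) : innerLoop W α f s S k = innerLoop W α f s' S k := by
  induction k with
  | zero => rfl
  | succ k ih =>
    rw [innerLoop, innerLoop, ih fun j hj => h j (hj.trans k.lt_succ_self), h k k.lt_succ_self]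

lemma outerLoop_congr {s s' : ℕ → ℕ → (i : Fin n) → Fin (m i)} {t : ℕ}
    (h : ∀ j < t, ∀ k < K, s j k = s' j k) :
    outerLoop W α f K x₀ s t = outerLoop W α f K x₀ s' t := by
  induction t with
  | zero => rfl
  | succ t ih =>
    rw [outerLoop, outerLoop, ih fun j hj => h j (hj.trans t.lt_succ_self)]
    exact innerLoop_congr _ (h t t.lt_succ_self)

variable (K n) in
/-- The positions of the indices drawn before step `k` of the inner loop of outer iteration
`t`. -/
def past (t k : ℕ) : Finset (ℕ × Fin K × Fin n) :=
  (Finset.range (t + 1) ×ˢ Finset.univ).filter fun q => q.1 < t ∨ (q.2.1 : ℕ) < k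

lemma mem_past {t k : ℕ} {q : ℕ × Fin K × Fin n} :
    q ∈ past n K t k ↔ q.1 < t ∨ (q.1 = t ∧ (q.2.1 : ℕ) < k) := by
  simp only [past, Finset.mem_filter, Finset.mem_product, Finset.mem_range, Finset.mem_univ,
    and_true]
  omega

/-- A sequence of indices with prescribed values at the positions in `F`. -/
def extendIndices (hm : ∀ i, 0 < m i) (F : Finset (ℕ × Fin K × Fin n))
    (a : (q : F) → Fin (m q.1.2.2)) (t k : ℕ) (i : Fin n) : Fin (m i) :=
  if h : k < K then
    if h' : (t, (⟨k, h⟩ : Fin K), i) ∈ F then a ⟨_, h'⟩ else ⟨0, hm i⟩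
  else ⟨0, hm i⟩

lemma extendIndices_apply (hm : ∀ i, 0 < m i) (F : Finset (ℕ × Fin K × Fin n))
    (s : ℕ → ℕ → (i : Fin n) → Fin (m i)) {t k : ℕ} (hk : k < K)
    (h : ∀ i, (t, (⟨k, hk⟩ : Fin K), i) ∈ F) :
    extendIndices hm F (fun q => s q.1.1 q.1.2.1 q.1.2.2) t k = s t k := by
  funext i
  simp [extendIndices, hk, h i]

lemma outerLoop_extendIndices (hm : ∀ i, 0 < m i) (s : ℕ → ℕ → (i : Fin n) → Fin (m i))
    {τ t : ℕ} (k : ℕ) (hτ : τ ≤ t) :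
    outerLoop W α f K x₀ (extendIndices hm (past n K t k) fun q => s q.1.1 q.1.2.1 q.1.2.2) τ =
      outerLoop W α f K x₀ s τ :=
  outerLoop_congr fun _ hj _ hk => extendIndices_apply hm _ s hk fun _ =>
    mem_past.2 (Or.inl (hj.trans_le hτ))

/-- The state is thus a function of the past draws alone: a finite-range variable independent of
each index drawn next. -/
lemma loopState_extendIndices (hm : ∀ i, 0 < m i) (s : ℕ → ℕ → (i : Fin n) → Fin (m i))
    (t : ℕ) {k : ℕ} (hk : k ≤ K) :
    loopState W α f K x₀ (extendIndices hm (past n K t k) fun q => s q.1.1 q.1.2.1 q.1.2.2) t k =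
      loopState W α f K x₀ s t k := by
  rw [loopState, loopState, outerLoop_extendIndices hm s k le_rfl]
  exact innerLoop_congr _ fun j hj => extendIndices_apply hm _ s (hj.trans_le hk) fun _ =>
    mem_past.2 (Or.inr ⟨rfl, hj⟩)

end Past

/-! ### Inner and outer loop recursions. -/

section Convergence

/-- A problem, a mixing matrix and a step-size for which the matrix `G_α` contracts the weights
`w` by the factor `γ ^ 2`. -/
structure Contractive {n p : ℕ} {m : Fin n → ℕ} (f : (i : Fin n) → Fin (m i) → Vec p → ℝ)
    (W : Matrix (Fin n) (Fin n) ℝ) (μ L α γ : ℝ) (xs : Vec p) (w : Fin 3 → ℝ) : Prop where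
  n_pos : 0 < n
  m_pos : ∀ i, 0 < m i
  mixing : W ∈ doublyStochastic ℝ (Fin n)
  spectral : secondSingularValue W < 1
  mu_pos : 0 < μ
  alpha_pos : 0 < α
  mu_le : μ ≤ L
  step : 47 * (L ^ 2 * α) ≤ μ
  diff : ∀ i j, Differentiable ℝ (f i j)
  convex : ∀ i j, IsStronglyConvex μ (f i j)
  smooth : ∀ i j, IsSmooth L (f i j)
  grad_eq : gradient (globalObj f) xs = 0
  weights : ∀ l, 0 ≤ w l
  rate_pos : 0 < γ
  rate_le : γ ≤ 1
  contract : ∀ l, (matG μ L (secondSingularValue W) α).mulVec w l ≤ γ ^ 2 * w l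

variable {Ω : Type*} [MeasurableSpace Ω] {P : Measure Ω}
  {n p : ℕ} {m : Fin n → ℕ} {f : (i : Fin n) → Fin (m i) → Vec p → ℝ} {μ L α c γ : ℝ}
  {W : Matrix (Fin n) (Fin n) ℝ} {xs : Vec p} {w : Fin 3 → ℝ} {K : ℕ} {x₀ : Fin n → Vec p}
  {s : ℕ → ℕ → (i : Fin n) → Ω → Fin (m i)}

lemma measurable_pastIndices (hs : IsUniformSampling K P s) (F : Finset (ℕ × Fin K × Fin n)) :
    Measurable fun ω (q : F) => s q.1.1 q.1.2.1 q.1.2.2 ω :=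
  measurable_pi_lambda _ fun q => hs.measurable _ _ _ q.1.2.1.2

/-- An index is independent of the indices drawn before. -/
lemma indepFun_past (hs : IsUniformSampling K P s) (t : ℕ) {k : ℕ} (hk : k < K) (i : Fin n) :
    IndepFun (fun ω (q : past n K t k) => s q.1.1 q.1.2.1 q.1.2.2 ω) (s t k i) P := by
  have hdisj : Disjoint (past n K t k) {(t, (⟨k, hk⟩ : Fin K), i)} := by
    rw [Finset.disjoint_singleton_right, mem_past]
    simp
  have h := hs.indep.indepFun_finset _ _ hdisj fun q => hs.measurable _ _ _ q.2.1.2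
  exact h.comp measurable_id (measurable_pi_apply
    (⟨_, Finset.mem_singleton_self _⟩ : ({(t, (⟨k, hk⟩ : Fin K), i)} : Finset _)))

lemma integrable_loopState [IsProbabilityMeasure P] (hm : ∀ i, 0 < m i)
    (hs : IsUniformSampling K P s) (t : ℕ) {k : ℕ} (hk : k ≤ K) (g : State n p → ℝ) :
    Integrable (fun ω => g (loopState W α f K x₀ (fun t k i => s t k i ω) t k)) P := by
  have h := integrable_comp_of_finite (P := P) (measurable_pastIndices hs (past n K t k)) fun a =>
    g (loopState W α f K x₀ (extendIndices hm (past n K t k) a) t k)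
  refine h.congr (Filter.Eventually.of_forall fun ω => ?_)
  exact congrArg g (loopState_extendIndices hm (fun t k i => s t k i ω) t hk)

/-- One iteration of the inner loop of outer iteration `t`, in terms of the random indices. -/
lemma Contractive.loopState_step [IsProbabilityMeasure P] (H : Contractive f W μ L α γ xs w)
    (hs : IsUniformSampling K P s)
    (hc : 0 ≤ c) {t k τ : ℕ} (hk : k < K) (hτ : τ ≤ t)
    (hS : MeanBound P f L xs w c (fun ω => loopState W α f K x₀ (fun t k i => s t k i ω) t k)
      fun ω => (outerLoop W α f K x₀ (fun t k i => s t k i ω) τ).x)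
    {c' : ℝ} (hcc : γ ^ 2 * c ≤ c') (hcc' : c' ≤ c)
    (hz : ∫ ω, ∑ i, ‖(outerLoop W α f K x₀ (fun t k i => s t k i ω) t).x i - xs‖ ^ 2 ∂P ≤
      c' * (w 0 + w 1)) :
    MeanBound P f L xs w c'
      (fun ω => loopState W α f K x₀ (fun t k i => s t k i ω) t (k + 1))
      (fun ω => (outerLoop W α f K x₀ (fun t k i => s t k i ω) t).x) ∧
    ∀ l, ∫ ω, errors xs (loopState W α f K x₀ (fun t k i => s t k i ω) t (k + 1)) l ∂P ≤
      γ ^ 2 * c * w l := by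
  have hm := H.m_pos
  have hX := measurable_pastIndices hs (past n K t k)
  have hSt : ∀ ω, loopState W α f K x₀ (fun t k i => s t k i ω) t k = loopState W α f K x₀
      (extendIndices hm (past n K t k) fun q => s q.1.1 q.1.2.1 q.1.2.2 ω) t k := fun ω =>
    (loopState_extendIndices hm (fun t k i => s t k i ω) t hk.le).symm
  have hOt : ∀ τ ≤ t, ∀ ω, outerLoop W α f K x₀ (fun t k i => s t k i ω) τ = outerLoop W α f K x₀
      (extendIndices hm (past n K t k) fun q => s q.1.1 q.1.2.1 q.1.2.2 ω) τ := fun τ hτ ω =>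
    (outerLoop_extendIndices hm (fun t k i => s t k i ω) k hτ).symm
  have hnext : ∀ ω, loopState W α f K x₀ (fun t k i => s t k i ω) t (k + 1) =
      innerStep W α f (outerLoop W α f K x₀ (fun t k i => s t k i ω) t).x (fun i => s t k i ω)
        (loopState W α f K x₀ (fun t k i => s t k i ω) t k) := fun ω => rfl
  simp only [hnext]
  simp only [hSt, hOt τ hτ] at hS
  simp only [hOt t le_rfl] at hz
  simp only [hSt, hOt t le_rfl]
  have hξ : ∀ i, Measurable (s t k i) := fun i => hs.measurable t k i hk
  have hu : ∀ i j, P.real (s t k i ⁻¹' {j}) = 1 / (m i : ℝ) := fun i => hs.uniform t k i hk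
  have hi := fun i => indepFun_past hs t hk i
  have h1 := MeanBound.step (c' := c')
    (S := fun a => loopState W α f K x₀ (extendIndices hm (past n K t k) a) t k)
    (r := fun a => (outerLoop W α f K x₀ (extendIndices hm (past n K t k) a) τ).x)
    (z := fun a => (outerLoop W α f K x₀ (extendIndices hm (past n K t k) a) t).x)
    H.n_pos H.m_pos H.mixing H.spectral H.mu_pos H.alpha_pos H.mu_le H.step H.diff H.convex H.smooth
    H.grad_eq H.weights hc H.contract hX hξ hu hi hS
  refine ⟨h1 hcc hcc' hz, fun l => ?_⟩
  have h3 := MeanBound.errors_innerStep_le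
    (S := fun a => loopState W α f K x₀ (extendIndices hm (past n K t k) a) t k)
    (r := fun a => (outerLoop W α f K x₀ (extendIndices hm (past n K t k) a) τ).x)
    (z := fun a => (outerLoop W α f K x₀ (extendIndices hm (past n K t k) a) t).x)
    H.n_pos H.m_pos H.mixing H.spectral H.mu_pos H.alpha_pos H.mu_le H.step H.diff H.convex H.smooth
    H.grad_eq H.weights hc hX hξ hu hi hS
    (hz.trans (mul_le_mul_of_nonneg_right hcc' (add_nonneg (H.weights 0) (H.weights 1)))) l
  refine h3.trans ((mul_le_mul_of_nonneg_left (H.contract l) hc).trans_eq ?_)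
  ring

/-- The inner loop of outer iteration `t`. -/
lemma Contractive.loopState_bound [IsProbabilityMeasure P] (H : Contractive f W μ L α γ xs w)
    (hs : IsUniformSampling K P s) (hc : 0 ≤ c) {t τ : ℕ} (hτ : τ ≤ t)
    (hS : MeanBound P f L xs w c (fun ω => outerLoop W α f K x₀ (fun t k i => s t k i ω) t)
      fun ω => (outerLoop W α f K x₀ (fun t k i => s t k i ω) τ).x)
    (hu : ∀ l, ∫ ω, errors xs (outerLoop W α f K x₀ (fun t k i => s t k i ω) t) l ∂P ≤
      γ * c * w l) {k : ℕ} (hk : k < K) :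
    MeanBound P f L xs w (γ * c)
      (fun ω => loopState W α f K x₀ (fun t k i => s t k i ω) t (k + 1))
      (fun ω => (outerLoop W α f K x₀ (fun t k i => s t k i ω) t).x) ∧
    ∀ l, ∫ ω, errors xs (loopState W α f K x₀ (fun t k i => s t k i ω) t (k + 1)) l ∂P ≤
      γ ^ 2 * c * w l := by
  have hγ := H.rate_pos
  have hγ1 := H.rate_le
  have hγc : 0 ≤ γ * c := by positivity
  have hle : γ * c ≤ c := mul_le_of_le_one_left hc hγ1
  have hle' : γ ^ 2 * c ≤ γ * c := by
    rw [pow_two, mul_assoc]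
    exact mul_le_of_le_one_left hγc hγ1
  have hz : ∫ ω, ∑ i, ‖(outerLoop W α f K x₀ (fun t k i => s t k i ω) t).x i - xs‖ ^ 2 ∂P ≤
      γ * c * (w 0 + w 1) := by
    simp only [sum_norm_sub_sq_eq_errors H.n_pos]
    rw [integral_add, mul_add]
    · exact add_le_add (hu 0) (hu 1)
    · exact integrable_loopState (W := W) (α := α) (k := 0) H.m_pos hs t (Nat.zero_le _)
          fun S => errors xs S 0
    · exact integrable_loopState (W := W) (α := α) (k := 0) H.m_pos hs t (Nat.zero_le _)
          fun S => errors xs S 1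
  induction k with
  -- Only this step uses the old reference point, hence the larger constant `c`. Afterwards the
  -- reference is the start of the current loop and the constant is `γ * c`.
  | zero => exact H.loopState_step hs hc (k := 0) hk hτ hS hle' hle hz
  | succ k ih =>
    obtain ⟨h1, -⟩ := ih (k.lt_succ_self.trans hk)
    have hmul : γ ^ 2 * (γ * c) ≤ γ ^ 2 * c := mul_le_mul_of_nonneg_left hle (sq_nonneg γ)
    obtain ⟨h2, h3⟩ := H.loopState_step hs hγc hk le_rfl h1 (hmul.trans hle') le_rfl hz
    exact ⟨h2, fun l => (h3 l).trans (mul_le_mul_of_nonneg_right hmul (H.weights l))⟩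

/-- Linear convergence of the outer loop, in terms of the weights. -/
lemma Contractive.outerLoop_bound [IsProbabilityMeasure P] (H : Contractive f W μ L α γ xs w)
    (hs : IsUniformSampling K P s) (hK : 0 < K) (hc : 0 ≤ c)
    (h₀ : ∀ l, ∫ ω, errors xs (outerLoop W α f K x₀ (fun t k i => s t k i ω) 0) l ∂P ≤ c * w l)
    (t : ℕ) (l : Fin 3) :
    ∫ ω, errors xs (outerLoop W α f K x₀ (fun t k i => s t k i ω) t) l ∂P ≤ c * γ ^ t * w l := by
  have hγ := H.rate_pos
  -- The gradients held at the start of loop `t` refer to the start of loop `t - 1`, hence the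
  -- constant one factor `γ` behind. For `t = 0` truncated subtraction makes the starting point its
  -- own reference, and its gradients are exact.
  suffices h : MeanBound P f L xs w (c * γ ^ t / γ)
      (fun ω => outerLoop W α f K x₀ (fun t k i => s t k i ω) t)
      (fun ω => (outerLoop W α f K x₀ (fun t k i => s t k i ω) (t - 1)).x) ∧
      ∀ l, ∫ ω, errors xs (outerLoop W α f K x₀ (fun t k i => s t k i ω) t) l ∂P ≤
        c * γ ^ t * w l from h.2 l
  clear l
  induction t with
  | zero =>
    have hle : c ≤ c / γ := le_div_self hc hγ H.rate_le
    have hgrad : ∀ ω i, (outerLoop W α f K x₀ (fun t k i => s t k i ω) 0).v i -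
        localGrad f (outerLoop W α f K x₀ (fun t k i => s t k i ω) 0).x i = 0 := fun ω i =>
      sub_self _
    simp only [pow_zero, mul_one, Nat.zero_sub]
    refine ⟨⟨fun ω => rfl, fun h i => ?_, ?_, fun l => (h₀ l).trans
      (mul_le_mul_of_nonneg_right hle (H.weights l)), ?_⟩, h₀⟩
    · simp only [hgrad, inner_zero_right, integral_zero]
    · simp only [gradErr, hgrad, norm_zero]
      simp
    · simp only [sum_norm_sub_sq_eq_errors H.n_pos]
      rw [integral_add]
      · have := mul_le_mul_of_nonneg_right hle (add_nonneg (H.weights 0) (H.weights 1))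
        linarith [h₀ 0, h₀ 1]
      · exact integrable_loopState (W := W) (α := α) (k := 0) H.m_pos hs 0 (Nat.zero_le _)
          fun S => errors xs S 0
      · exact integrable_loopState (W := W) (α := α) (k := 0) H.m_pos hs 0 (Nat.zero_le _)
          fun S => errors xs S 1
  | succ t ih =>
    obtain ⟨k, rfl⟩ : ∃ k, K = k + 1 := ⟨K - 1, by omega⟩
    have e1 : γ * (c * γ ^ t / γ) = c * γ ^ t := by field_simp
    have e2 : γ ^ 2 * (c * γ ^ t / γ) = c * γ ^ (t + 1) := by field_simp; ring
    have e3 : c * γ ^ (t + 1) / γ = c * γ ^ t := by field_simp; ring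
    obtain ⟨h1, h2⟩ := H.loopState_bound (x₀ := x₀) hs (by positivity) (Nat.sub_le t 1) ih.1
      (by rw [e1]; exact ih.2) k.lt_succ_self
    rw [e1] at h1
    rw [e2] at h2
    rw [e3]
    exact ⟨h1, h2⟩

lemma errors_eq_zero_of_subsingleton [Subsingleton (Vec p)] (xs : Vec p) (S : State n p)
    (l : Fin 3) : errors xs S l = 0 := by
  fin_cases l <;> simp [errors, norm_of_subsingleton]

end Convergence

end GTSVRG

/-! ### Choice of the constants and conclusion. -/

theorem theorem2 (μ L σ α : ℝ) (K : ℕ) (hμ : 0 < μ) (hL : 0 < L) (hα : 0 < α) (hK : 0 < K)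
    (hρ : GTSVRG.rho (GTSVRG.outerMatrix μ L σ α K) < 1) :
    ∃ γ C : ℝ, 0 ≤ γ ∧ γ < 1 ∧ 0 ≤ C ∧
      ∀ (n p : ℕ) (m : Fin n → ℕ) (f : (i : Fin n) → Fin (m i) → GTSVRG.Vec p → ℝ)
        (W : Matrix (Fin n) (Fin n) ℝ),
        0 < n → (∀ i, 0 < m i) →
        (∀ i j, Differentiable ℝ (f i j)) →
        (∀ i j, GTSVRG.IsStronglyConvex μ (f i j)) →
        (∀ i j, GTSVRG.IsSmooth L (f i j)) →
        W.IsPrimitive → W ∈ doublyStochastic ℝ (Fin n) →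
        GTSVRG.secondSingularValue W = σ →
        ∃ xstar : GTSVRG.Vec p,
          (∀ z, z ≠ xstar → GTSVRG.globalObj f xstar < GTSVRG.globalObj f z) ∧
          ∀ (Ω : Type*) [MeasurableSpace Ω] (P : Measure Ω) [IsProbabilityMeasure P]
            (s : ℕ → ℕ → (i : Fin n) → Ω → Fin (m i)) (x₀ : Fin n → GTSVRG.Vec p),
            GTSVRG.IsUniformSampling K P s →
            ∀ (t : ℕ) (l : Fin 3),
              Integrable (fun ω => GTSVRG.errors xstar
                (GTSVRG.outerLoop W α f K x₀ (fun t k i => s t k i ω) t) l) P ∧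
              ∫ ω, GTSVRG.errors xstar
                  (GTSVRG.outerLoop W α f K x₀ (fun t k i => s t k i ω) t) l ∂P ≤
                C * γ ^ t * ∑ j, ∫ ω, GTSVRG.errors xstar
                  (GTSVRG.outerLoop W α f K x₀ (fun t k i => s t k i ω) 0) j ∂P := by
  -- The constants are chosen before the problem, so parameters that no problem in positive
  -- dimension can have are treated separately.
  by_cases hcase : (0 ≤ σ ∧ σ < 1) ∧ μ ≤ L
  · obtain ⟨⟨hσ0, hσ1⟩, hμL⟩ := hcase
    obtain ⟨w, γ₀, hγ0, hγ1, hw, hG⟩ := GTSVRG.exists_weights hμ hL hα hσ0 hσ1 hμL hK hρ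
    -- `47² = 2209 ≤ 2240`.
    have hstep : 47 * (L ^ 2 * α) ≤ μ := by
      have h := GTSVRG.step_size_bound hμ hα hσ0 hσ1 hγ1 hw hG
      refine (pow_le_pow_iff_left₀ (by positivity) hμ.le two_ne_zero).1 (le_trans ?_ h)
      have : 0 ≤ L ^ 4 * α ^ 2 := by positivity
      linarith
    have hw0 : ∀ l, 0 ≤ w l := fun l => zero_le_one.trans (hw l)
    -- The square root leaves one factor for the lag of the reference point; `1 / 4` only keeps `γ`
    -- positive.
    set γ := √(max γ₀ (1 / 4)) with hγ
    have hγsq : γ ^ 2 = max γ₀ (1 / 4) := Real.sq_sqrt (by positivity)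
    have hγpos : 0 < γ := Real.sqrt_pos.2 (by positivity)
    have hγlt : γ < 1 := by
      rw [hγ, Real.sqrt_lt' one_pos, one_pow]
      exact max_lt hγ1 (by norm_num)
    refine ⟨γ, ∑ l, w l, hγpos.le, hγlt, Finset.sum_nonneg fun l _ => hw0 l, ?_⟩
    intro n p m f W hn hm hd hsc hsm _ hW hWσ
    obtain ⟨xs, hxs, hmin⟩ := GTSVRG.exists_minimizer hμ (GTSVRG.differentiable_globalObj hd)
      (GTSVRG.isStronglyConvex_globalObj hn hm hd hsc)
    refine ⟨xs, hmin, ?_⟩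
    intro Ω _ P _ s x₀ hs t l
    have H : GTSVRG.Contractive f W μ L α γ xs w :=
      { n_pos := hn
        m_pos := hm
        mixing := hW
        spectral := hWσ.trans_lt hσ1
        mu_pos := hμ
        alpha_pos := hα
        mu_le := hμL
        step := hstep
        diff := hd
        convex := hsc
        smooth := hsm
        grad_eq := hxs
        weights := hw0
        rate_pos := hγpos
        rate_le := hγlt.le
        contract := fun l => by
          rw [hWσ, hγsq]
          exact (hG l).trans (mul_le_mul_of_nonneg_right (le_max_left _ _) (hw0 l)) }
    refine ⟨GTSVRG.integrable_loopState (k := 0) hm hs t (Nat.zero_le _)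
      fun S => GTSVRG.errors xs S l, ?_⟩
    have hnn : ∀ j, 0 ≤ ∫ ω, GTSVRG.errors xs
        (GTSVRG.outerLoop W α f K x₀ (fun t k i => s t k i ω) 0) j ∂P := fun j =>
      integral_nonneg fun ω => GTSVRG.errors_nonneg _ _ _
    set c := ∑ j, ∫ ω, GTSVRG.errors xs
      (GTSVRG.outerLoop W α f K x₀ (fun t k i => s t k i ω) 0) j ∂P with hc
    have hc0 : 0 ≤ c := Finset.sum_nonneg fun j _ => hnn j
    -- The total initial error `c` is an admissible start because every weight is at least `1`.
    have h := H.outerLoop_bound (x₀ := x₀) (c := c) hs hK hc0 (fun j =>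
      (Finset.single_le_sum (fun j _ => hnn j) (Finset.mem_univ j)).trans
        (le_mul_of_one_le_right hc0 (hw j))) t l
    refine h.trans ?_
    rw [mul_comm _ c, ← mul_assoc, mul_right_comm]
    gcongr
    exact Finset.single_le_sum (fun j _ => hw0 j) (Finset.mem_univ l)
  -- For an actual `W`, `σ` lies in `[0, 1]` and differs from `1` by the spectral condition. So `L <
  -- μ`, the space is a point, and all errors vanish.
  · refine ⟨0, 0, le_rfl, one_pos, le_rfl, ?_⟩
    intro n p m f W hn hm _ hsc hsm _ hW hWσ
    have hσ0 : 0 ≤ σ := hWσ ▸ GTSVRG.secondSingularValue_nonneg W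
    have hσ1 : σ ≤ 1 := hWσ ▸ GTSVRG.secondSingularValue_le_one hW
    have hσne : σ ≠ 1 := fun h => GTSVRG.not_rho_outerMatrix_lt_one_of_eq_one h hρ
    have hlt : L < μ := not_le.1 fun h => hcase ⟨⟨hσ0, lt_of_le_of_ne hσ1 hσne⟩, h⟩
    have hsub : Subsingleton (GTSVRG.Vec p) :=
      GTSVRG.subsingleton_of_lt (hsc ⟨0, hn⟩ ⟨0, hm _⟩) (hsm ⟨0, hn⟩ ⟨0, hm _⟩) hlt
    refine ⟨0, fun z hz => absurd (Subsingleton.elim z 0) hz, ?_⟩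
    intro Ω _ P _ s x₀ _ t l
    simp [GTSVRG.errors_eq_zero_of_subsingleton]
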